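/- **Conventions.** Let $x$, $t=\tau_0$, $\tau_1,\tau_2,\dots$ be independent variables. A *differential function* is a smooth function of finitely many of the variables $x,\tau_i$ and finitely many of $u,u_x,u_{xx},\dots$. For differential functions $F_i$, $i\ge 0$, put $$D_x=\partial_x+\sum_j u_{x^{j+1}}\,\partial_{u_{x^j}},\qquad D_{\tau_i}=\partial_{\tau_i}+\sum_j (D_x^jF_i)\,\partial_{u_{x^j}} .$$ The equations $u_{\tau_i}=F_i$, $i\ge 0$, form a *hierarchy of strictly pseudo-spherical type* with associated differential functions $f_{\alpha 1},f_{\alpha 2},h_{\alpha i}$ ($\alpha=1,2,3$, $i\ge1$) if, for every $n\ge 0$, the one-forms $\Theta^{[n]}_\alpha=f_{\alpha1}dx+f_{\alpha2}dt+\sum_{i=1}^n h_{\alpha i}d\tau_i$ satisfy $$d_H\Theta_1^{[n]}=\Theta_3^{[n]}\wedge\Theta_2^{[n]},\quad d_H\Theta_2^{[n]}=\Theta_1^{[n]}\wedge\Theta_3^{[n]},\quad d_H\Theta_3^{[n]}=\Theta_1^{[n]}\wedge\Theta_2^{[n]}$$ identically, where $d_H g=D_xg\,dx+\sum_{i=0}^nD_{\tau_i}g\,d\tau_i$;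 and if moreover $f_{11,u}^2+f_{21,u}^2+f_{31,u}^2\neq0$ everywhere, the $f_{\alpha1}$ do not depend on $u_{x^k}$ for $k\ge1$, and $f_{\alpha2}$ (respectively $h_{\alpha i}$) does not depend on $u_{x^k}$ for $k$ at least the order of $F_0$ (respectively $F_i$). View $\mathbf R^{n+2}$, with coordinates $(x,t,\tau_1,\dots,\tau_n)$, as the hyperplane $\tau_{n+1}=0$ of $\mathbf R^{n+3}$; a differential function is evaluated on a function on $\mathbf R^{n+2}$ with $\tau_j=0$ for $j>n$. *Nested domains* are open sets $V^{[n]}\subseteq\mathbf R^{n+2}$, $n\ge0$, with $V^{[0]}\ne\emptyset$ and $V^{[n]}\subseteq V^{[n+1]}$. A *solution* of the hierarchy is a sequence $\{u^{[n]}\}_{n\ge0}$ of smooth functions on nested domains such that $u^{[n]}$ satisfies $u_{\tau_i}=F_i$ for $i=0,\dots,n$ and $u^{[n+1]}$ restricts to $u^{[n]}$. The function $u^{[0]}$ is *III-generic* if $f_{11}f_{22}-f_{12}f_{21}$, evaluated on $u^{[0]}$, vanishes nowhere on its domain. **Theorem.** Let $u_{\tau_i}=F_i$ and $\widehat u_{\widehat\tau_i}=\widehat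 F_i$ be two hierarchies of strictly pseudo-spherical type, with associated functions $f_{\alpha\beta},h_{\alpha i}$ and $\widehat f_{\alpha\beta},\widehat h_{\alpha i}$. Assume that $\widehat f_{11}=G(\widehat u)$ with $G:\mathbf R\to\mathbf R$ smooth and $G'\neq0$ everywhere. Let $\{u^{[n]}\}$ be a solution of the first hierarchy with $u^{[0]}$ III-generic. Let $V^{[n]}$ be nested domains contained in the domains of the $u^{[n]}$, and let $\Upsilon^{[n]}=(\psi,\varphi,\phi_1,\dots,\phi_n):V^{[n]}\to\mathbf R^{n+2}$ be local diffeomorphisms and $\mu^{[n]}:V^{[n]}\to\mathbf R$ smooth functions, such that $\Upsilon^{[n+1]}$, $\mu^{[n+1]}$ restrict to $\Upsilon^{[n]}$, $\mu^{[n]}$ on $V^{[n]}$. Let $\Delta^{[n]}$ be the Jacobian determinant of $\Upsilon^{[n]}$ (rows: derivatives with respect to $x,t,\tau_1,\dots,\tau_n$; columns: components of $\Upsilon^{[n]}$), and let $\Delta^{[n]}_c$ be obtained from it by replacing its $c$-th column by the column with entries $$f_{11}\cos\mu+f_{21}\sin\mu,\quad f_{12}\cos\mu+f_{22}\sin\mu,\quad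 h_{1j}\cos\mu+h_{2j}\sin\mu\ \ (1\le j\le n),$$ evaluated on $u^{[n]}$, with $\mu=\mu^{[n]}$. Suppose that, for every $n\ge0$, $\Upsilon^{[n]}$ and $\mu^{[n]}$ satisfy on $V^{[n]}$ the system $$\Delta^{[n]}\,\widehat g_{12}=\Delta_2^{[n]},\qquad \Delta^{[n]}\,\widehat H_{1j}=\Delta^{[n]}_{j+2}\quad(1\le j\le n),$$ $$\widehat g_{21}\psi_x+\widehat g_{22}\varphi_x+\sum_{i=1}^n\widehat H_{2i}\phi_{i,x}=f_{21}\cos\mu-f_{11}\sin\mu,$$ $$\widehat g_{21}\psi_t+\widehat g_{22}\varphi_t+\sum_{i=1}^n\widehat H_{2i}\phi_{i,t}=f_{22}\cos\mu-f_{12}\sin\mu,$$ $$\widehat g_{21}\psi_{\tau_j}+\widehat g_{22}\varphi_{\tau_j}+\sum_{i=1}^n\widehat H_{2i}\phi_{i,\tau_j}=h_{2j}\cos\mu-h_{1j}\sin\mu\quad(1\le j\le n),$$ $$\widehat g_{31}\psi_x+\widehat g_{32}\varphi_x+\sum_{i=1}^n\widehat H_{3i}\phi_{i,x}=f_{31}+\mu_x,\qquad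 \widehat g_{31}\psi_t+\widehat g_{32}\varphi_t+\sum_{i=1}^n\widehat H_{3i}\phi_{i,t}=f_{32}+\mu_t,$$ $$\widehat g_{31}\psi_{\tau_j}+\widehat g_{32}\varphi_{\tau_j}+\sum_{i=1}^n\widehat H_{3i}\phi_{i,\tau_j}=h_{3j}+\mu_{\tau_j}\quad(1\le j\le n).$$ Here $\widehat g_{\alpha\beta}=\widehat f_{\alpha\beta}\circ\Upsilon^{[n]}$ and $\widehat H_{\alpha j}=\widehat h_{\alpha j}\circ\Upsilon^{[n]}$ are evaluated by means of $G(\widehat u)\circ\Upsilon^{[n]}=\Delta_1^{[n]}/\Delta^{[n]}$: it is part of the hypothesis that $\Delta_1^{[n]}/\Delta^{[n]}$ takes its values in the range of $G$; $\widehat u\circ\Upsilon^{[n]}$ stands for $G^{-1}(\Delta_1^{[n]}/\Delta^{[n]})$, and the $\widehat x$-derivatives of $\widehat u$ along $\Upsilon^{[n]}$ are obtained from this function by the chain rule. Then: 1. Every point of $V^{[0]}$ lies in $W^{[0]}$ for some nested domains $W^{[n]}\subseteq V^{[n]}$ such that every $\Upsilon^{[n]}$ is injective on $W^{[n]}$.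 2. For all nested domains $W^{[n]}\subseteq V^{[n]}$ such that every $\Upsilon^{[n]}$ is injective on $W^{[n]}$, the formula $$\widehat f_{11}\circ\Upsilon^{[n]}=\frac{\Delta_1^{[n]}}{\Delta^{[n]}}\quad\text{on } W^{[n]},\ n\ge0,$$ in which $\widehat f_{11}$ is evaluated on $\widehat u^{[n]}$, determines unique functions $\widehat u^{[n]}$ on the sets $\Upsilon^{[n]}(W^{[n]})$; these sets are nested domains, $\{\widehat u^{[n]}\}$ is a solution of the hierarchy $\widehat u_{\widehat\tau_i}=\widehat F_i$, and $\widehat u^{[0]}$ is III-generic. -/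

import Mathlib

open scoped ContDiff Manifold

noncomputable section

namespace PSS

/-! ### Jet space, differential functions, total derivatives -/

/-- A point of the space with coordinates `x, t = τ₀, τ₁, τ₂, …, u, u_x, u_{xx}, …`.
`y 0` is `x` and `y (i + 1)` is `τ_i`; `u j` is the jet coordinate `u_{x^j}`. -/
structure Jet where
  y : ℕ → ℝ
  u : ℕ → ℝ

/-- A differential function: a smooth function of finitely many of the independent variables and
finitely many of the jet coordinates. -/
def IsDifferentialFunction (P : Jet → ℝ) : Prop :=
  ∃ (N : ℕ) (f : (Fin N → ℝ) × (Fin N → ℝ) → ℝ), ContDiff ℝ ∞ f ∧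
    ∀ z : Jet, P z = f (fun i => z.y i, fun i => z.u i)

/-- Partial derivative with respect to the independent variable `y a`
(`x` if `a = 0`, `τ_i` if `a = i + 1`). -/
def baseDeriv (a : ℕ) (P : Jet → ℝ) (z : Jet) : ℝ :=
  deriv (fun s => P ⟨Function.update z.y a s, z.u⟩) (z.y a)

/-- Partial derivative with respect to `u_{x^j}`. -/
def jetDeriv (j : ℕ) (P : Jet → ℝ) (z : Jet) : ℝ :=
  deriv (fun s => P ⟨z.y, Function.update z.u j s⟩) (z.u j)

/-- The order of a differential function: the least `k` such that it does not depend on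
`u_{x^j}` for `j > k`. -/
def diffOrder (P : Jet → ℝ) : ℕ :=
  sInf {k | ∀ j, k < j → ∀ z, jetDeriv j P z = 0}

/-- `D_x = ∂/∂x + ∑_j u_{x^{j+1}} ∂/∂u_{x^j}`; on a differential function the sum is finite. -/
def totalX (P : Jet → ℝ) : Jet → ℝ := fun z =>
  baseDeriv 0 P z + ∑ᶠ j : ℕ, z.u (j + 1) * jetDeriv j P z

/-- `D_{τ_i} = ∂/∂τ_i + ∑_j (D_x^j F_i) ∂/∂u_{x^j}`. -/
def totalTau (F : ℕ → Jet → ℝ) (i : ℕ) (P : Jet → ℝ) : Jet → ℝ := fun z =>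
  baseDeriv (i + 1) P z + ∑ᶠ j : ℕ, (totalX^[j] (F i)) z * jetDeriv j P z

/-- The total derivative in the direction of the independent variable `y a`:
`D_x` for `a = 0`, `D_{τ_i}` for `a = i + 1`. -/
def total (F : ℕ → Jet → ℝ) : ℕ → (Jet → ℝ) → Jet → ℝ
  | 0 => totalX
  | i + 1 => totalTau F i

/-! ### Hierarchies of strictly pseudo-spherical type -/

/-- The evolution equations `u_{τ_i} = F_i`, `i ≥ 0`, form a hierarchy of pseudo-spherical type with
associated one-forms `Θ_α^{[n]} = f_{α1} dx + f_{α2} dt + ∑_{i=1}^n h_{αi} dτ_i`.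
The coefficients are collected in one family: with `α = 0, 1, 2` in place of `α = 1, 2, 3`,
`θ α 0 = f_{α1}`, `θ α 1 = f_{α2}` and `θ α (i + 1) = h_{αi}` for `i ≥ 1`.
The last three fields are the coefficients of the equations
`d_H Θ₁ = Θ₃ ∧ Θ₂`, `d_H Θ₂ = Θ₁ ∧ Θ₃`, `d_H Θ₃ = Θ₁ ∧ Θ₂`. -/
structure IsPSSHierarchy (F : ℕ → Jet → ℝ) (θ : Fin 3 → ℕ → Jet → ℝ) : Prop where
  diff_F : ∀ i, IsDifferentialFunction (F i)
  diff_θ : ∀ α a, IsDifferentialFunction (θ α a)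
  struct₁ : ∀ a b z, total F a (θ 0 b) z - total F b (θ 0 a) z =
    θ 2 a z * θ 1 b z - θ 2 b z * θ 1 a z
  struct₂ : ∀ a b z, total F a (θ 1 b) z - total F b (θ 1 a) z =
    θ 0 a z * θ 2 b z - θ 0 b z * θ 2 a z
  struct₃ : ∀ a b z, total F a (θ 2 b) z - total F b (θ 2 a) z =
    θ 0 a z * θ 1 b z - θ 0 b z * θ 1 a z

/-- The hierarchy `u_{τ_i} = F_i` is of strictly pseudo-spherical type with associated functions
`θ`: moreover the functions `f_{α1}` depend on no `x`-derivative of `u`, the function `f_{α2}`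
(resp. `h_{αi}`) depends only on derivatives of order smaller than the order of `F_0` (resp. `F_i`),
and `f_{11,u}² + f_{21,u}² + f_{31,u}² ≠ 0`. -/
structure IsStrictPSSHierarchy (F : ℕ → Jet → ℝ) (θ : Fin 3 → ℕ → Jet → ℝ) : Prop
    extends IsPSSHierarchy F θ where
  nondeg : ∀ z, jetDeriv 0 (θ 0 0) z ^ 2 + jetDeriv 0 (θ 1 0) z ^ 2 +
    jetDeriv 0 (θ 2 0) z ^ 2 ≠ 0
  space_part : ∀ α j, 1 ≤ j → ∀ z, jetDeriv j (θ α 0) z = 0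
  time_part : ∀ α i j, diffOrder (F i) ≤ j → ∀ z, jetDeriv j (θ α (i + 1)) z = 0

/-! ### Solutions

`Fin (n + 2) → ℝ` is the space of the variables `(x, t, τ₁, …, τ_n)`. It sits in the space of the
variables `(x, t, τ₁, …, τ_{n+1})` as the hyperplane `τ_{n+1} = 0`, through `p ↦ Fin.snoc p 0`. -/

/-- Partial derivative of a function of `m` real variables. -/
def pd {m : ℕ} (r : Fin m) (g : (Fin m → ℝ) → ℝ) (p : Fin m → ℝ) : ℝ :=
  fderiv ℝ g p (Pi.single r 1)

/-- The values of all independent variables at a point of `ℝ^{n+2}`: the missing ones are `0`. -/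
def extendByZero {m : ℕ} (p : Fin m → ℝ) : ℕ → ℝ := fun k =>
  if h : k < m then p ⟨k, h⟩ else 0

/-- The jet of `g` at `p`; `P (jet g p)` is the value at `p` of the differential function `P`
on `u = g`. -/
def jet {n : ℕ} (g : (Fin (n + 2) → ℝ) → ℝ) (p : Fin (n + 2) → ℝ) : Jet where
  y := extendByZero p
  u := fun j => ((pd 0)^[j] g) p

/-- Nonempty open sets `V^{[n]} ⊆ ℝ^{n+2}` with `V^{[n]} ⊆ V^{[n+1]}`. -/
structure NestedDomains (V : ∀ n : ℕ, Set (Fin (n + 2) → ℝ)) : Prop where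
  isOpen : ∀ n, IsOpen (V n)
  nonempty : (V 0).Nonempty
  nested : ∀ n, ∀ p ∈ V n, (Fin.snoc p 0 : Fin (n + 1 + 2) → ℝ) ∈ V (n + 1)

/-- `{u^{[n]}}`, with `u^{[n]}` defined on `V^{[n]}`, is a local solution of the hierarchy
`u_{τ_i} = F_i`, `i ≥ 0`. -/
structure IsSolution (F : ℕ → Jet → ℝ) (V : ∀ n : ℕ, Set (Fin (n + 2) → ℝ))
    (u : ∀ n : ℕ, (Fin (n + 2) → ℝ) → ℝ) : Prop where
  domains : NestedDomains V
  smooth : ∀ n, ContDiffOn ℝ ∞ (u n) (V n)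
  equation : ∀ n, ∀ i : Fin (n + 1), ∀ p ∈ V n, pd i.succ (u n) p = F i (jet (u n) p)
  restrict : ∀ n, ∀ p ∈ V n, u (n + 1) (Fin.snoc p 0) = u n p

/-- `v(x,t)` is III-generic on `V`: the pull-back of `Θ₁^{[0]} ∧ Θ₂^{[0]}` vanishes nowhere. -/
def IsIIIGeneric (θ : Fin 3 → ℕ → Jet → ℝ) (V : Set (Fin (0 + 2) → ℝ))
    (v : (Fin (0 + 2) → ℝ) → ℝ) : Prop :=
  ∀ p ∈ V, θ 0 0 (jet v p) * θ 1 1 (jet v p) - θ 0 1 (jet v p) * θ 1 0 (jet v p) ≠ 0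

/-! ### The first-order system -/

/-- The Jacobian matrix of `Υ = (ψ, φ, φ₁, …, φ_n)`: rows are indexed by the variables
`x, t, τ₁, …, τ_n` of differentiation, columns by the components of `Υ`. -/
def jac {m : ℕ} (Υ : (Fin m → ℝ) → (Fin m → ℝ)) (p : Fin m → ℝ) : Matrix (Fin m) (Fin m) ℝ :=
  Matrix.of fun r c => pd r (fun q => Υ q c) p

/-- The determinant `Δ`. -/
def Del {m : ℕ} (Υ : (Fin m → ℝ) → (Fin m → ℝ)) (p : Fin m → ℝ) : ℝ := (jac Υ p).det

/-- The column of the coefficients of `Θ₁ cos μ + Θ₂ sin μ`, pulled back by `u`. -/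
def rotCol {n : ℕ} (θ : Fin 3 → ℕ → Jet → ℝ) (u μ : (Fin (n + 2) → ℝ) → ℝ)
    (p : Fin (n + 2) → ℝ) : Fin (n + 2) → ℝ := fun r =>
  θ 0 r (jet u p) * Real.cos (μ p) + θ 1 r (jet u p) * Real.sin (μ p)

/-- The determinant obtained from `Δ` by replacing column `c` by `rotCol`. The columns are numbered
from `0`, so that `DelCol … 0`, `DelCol … 1`, … are `Δ₁`, `Δ₂`, …. -/
def DelCol {n : ℕ} (θ : Fin 3 → ℕ → Jet → ℝ) (u : (Fin (n + 2) → ℝ) → ℝ)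
    (Υ : (Fin (n + 2) → ℝ) → (Fin (n + 2) → ℝ)) (μ : (Fin (n + 2) → ℝ) → ℝ)
    (c : Fin (n + 2)) (p : Fin (n + 2) → ℝ) : ℝ :=
  ((jac Υ p).updateCol c (rotCol θ u μ p)).det

/-- The derivation `∂/∂x̂`, expressed in the variables `(x, t, τ₁, …, τ_n)` by the chain rule:
if `w = v ∘ Υ` then `∇w = (jac Υ) (∇v ∘ Υ)`, so that `v_{x̂} ∘ Υ` is component `0` of
`(jac Υ)⁻¹ ∇w`. -/
def xhatDeriv {n : ℕ} (Υ : (Fin (n + 2) → ℝ) → (Fin (n + 2) → ℝ))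
    (w : (Fin (n + 2) → ℝ) → ℝ) (p : Fin (n + 2) → ℝ) : ℝ :=
  ((jac Υ p)⁻¹.mulVec fun r => pd r w p) 0

/-- The jet of `û` at `Υ p`, in terms of `Υ` and `w = û ∘ Υ` alone. -/
def hatJet {n : ℕ} (Υ : (Fin (n + 2) → ℝ) → (Fin (n + 2) → ℝ))
    (w : (Fin (n + 2) → ℝ) → ℝ) (p : Fin (n + 2) → ℝ) : Jet where
  y := extendByZero (Υ p)
  u := fun j => ((xhatDeriv Υ)^[j] w) p

/-- `(Υ, μ)` solves, on the set `V`, the system of first-order equations determined by `u`: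
with `ĝ_{αc} = θ̂_{αc} ∘ Υ` evaluated by means of `G(û) ∘ Υ = Δ₁ / Δ`,
`Δ ĝ_{1c} = Δ_c` for every column `c` other than the first,
`∑_c ĝ_{2c} ∂_r Υ_c = θ_{2r} cos μ - θ_{1r} sin μ` and `∑_c ĝ_{3c} ∂_r Υ_c = θ_{3r} + ∂_r μ`
for every `r ∈ {x, t, τ₁, …, τ_n}`. -/
def SolvesSystem {n : ℕ} (θ θh : Fin 3 → ℕ → Jet → ℝ) (G : ℝ → ℝ)
    (u : (Fin (n + 2) → ℝ) → ℝ) (V : Set (Fin (n + 2) → ℝ))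
    (Υ : (Fin (n + 2) → ℝ) → (Fin (n + 2) → ℝ)) (μ : (Fin (n + 2) → ℝ) → ℝ) : Prop :=
  ∃ w : (Fin (n + 2) → ℝ) → ℝ,
    (∀ p ∈ V, G (w p) = DelCol θ u Υ μ 0 p / Del Υ p) ∧
    (∀ p ∈ V, ∀ c : Fin (n + 2), c ≠ 0 →
      Del Υ p * θh 0 c (hatJet Υ w p) = DelCol θ u Υ μ c p) ∧
    (∀ p ∈ V, ∀ r : Fin (n + 2),
      ∑ c : Fin (n + 2), θh 1 c (hatJet Υ w p) * pd r (fun q => Υ q c) p =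
        θ 1 r (jet u p) * Real.cos (μ p) - θ 0 r (jet u p) * Real.sin (μ p)) ∧
    (∀ p ∈ V, ∀ r : Fin (n + 2),
      ∑ c : Fin (n + 2), θh 2 c (hatJet Υ w p) * pd r (fun q => Υ q c) p =
        θ 2 r (jet u p) + pd r μ p)

end PSS

end

namespace PSS

/-! ### Partial derivatives -/

/-! On a solution, the forms `Θ_α` satisfy the structure equations of a metric of curvature -1.
These equations survive a rotation of the coframe by `μ`, provided `dμ` is added to the connection
form (`StructureEquations.rotForms`). They also descend along a local diffeomorphism, because `d`
and `∧` commute with pull-back and the Jacobian matrix is invertible (`StructureEquations.of_pull`).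

By Cramer's rule, the first-order system together with `G(û) ∘ Υ = Δ₁/Δ` says exactly that `Υ` pulls
the hatted forms, evaluated on `û = G⁻¹(Δ₁/Δ) ∘ Υ⁻¹`, back to the rotated forms of `u`. Hence the
hatted forms satisfy the structure equations on `û`. This forces the equations of the hierarchy
(`equation_of_structureEquations`): since `f̂_{α1}` contains no derivatives of `û`, the `dx ∧ dτ_i`
coefficient differs from the identity valid on jet space only by `(û_{τ_i} - F̂_i) f̂_{α1,u}`, and
the three factors `f̂_{α1,u}` never vanish simultaneously.

The levels fit together because the Cramer solution restricts to the hyperplane `τ_{n+1} = 0`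
(`DelCol_div_Del_restrict`). Genericity passes over because `Θ₁ ∧ Θ₂` is invariant under rotation.
Nested domains of injectivity come from a chain of compact sets (`exists_nested_injOn`). -/

theorem contDiffOn_pd {m : ℕ} {S : Set (Fin m → ℝ)} (hS : IsOpen S) {g : (Fin m → ℝ) → ℝ}
    (hg : ContDiffOn ℝ ∞ g S) (r : Fin m) : ContDiffOn ℝ ∞ (pd r g) S :=
  (hg.fderiv_of_isOpen hS (by simp)).clm_apply contDiffOn_const

theorem contDiffOn_iterate_pd {m : ℕ} {S : Set (Fin m → ℝ)} (hS : IsOpen S)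
    {g : (Fin m → ℝ) → ℝ} (hg : ContDiffOn ℝ ∞ g S) (r : Fin m) (j : ℕ) :
    ContDiffOn ℝ ∞ ((pd r)^[j] g) S := by
  induction j with
  | zero => exact hg
  | succ j ih => rw [Function.iterate_succ_apply']; exact contDiffOn_pd hS ih r

theorem differentiableAt_of_contDiffOn {m : ℕ} {S : Set (Fin m → ℝ)} (hS : IsOpen S)
    {H : Type*} [NormedAddCommGroup H] [NormedSpace ℝ H] {g : (Fin m → ℝ) → H}
    (hg : ContDiffOn ℝ ∞ g S) {p : Fin m → ℝ} (hp : p ∈ S) : DifferentiableAt ℝ g p :=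
  (hg.contDiffAt (hS.mem_nhds hp)).differentiableAt (by simp)

theorem pd_congr {m : ℕ} {S : Set (Fin m → ℝ)} (hS : IsOpen S) {g h : (Fin m → ℝ) → ℝ}
    (hgh : Set.EqOn g h S) (r : Fin m) : Set.EqOn (pd r g) (pd r h) S := fun p hp => by
  unfold pd
  rw [Filter.EventuallyEq.fderiv_eq (Filter.eventuallyEq_of_mem (hS.mem_nhds hp) hgh)]

theorem iterate_pd_congr {m : ℕ} {S : Set (Fin m → ℝ)} (hS : IsOpen S) {g h : (Fin m → ℝ) → ℝ}
    (hgh : Set.EqOn g h S) (r : Fin m) (j : ℕ) :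
    Set.EqOn ((pd r)^[j] g) ((pd r)^[j] h) S := by
  induction j with
  | zero => exact hgh
  | succ j ih => simp only [Function.iterate_succ_apply']; exact pd_congr hS ih r

theorem pd_comm {m : ℕ} {S : Set (Fin m → ℝ)} (hS : IsOpen S) {g : (Fin m → ℝ) → ℝ}
    (hg : ContDiffOn ℝ ∞ g S) (r s : Fin m) {p : Fin m → ℝ} (hp : p ∈ S) :
    pd r (pd s g) p = pd s (pd r g) p := by
  have hd : DifferentiableAt ℝ (fderiv ℝ g) p :=
    differentiableAt_of_contDiffOn hS (hg.fderiv_of_isOpen hS (m := ∞) (by simp)) hp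
  have key : ∀ a b : Fin m,
      pd a (pd b g) p = fderiv ℝ (fderiv ℝ g) p (Pi.single a 1) (Pi.single b 1) := by
    intro a b
    unfold pd
    rw [fderiv_clm_apply hd (differentiableAt_const _)]
    simp
  rw [key, key]
  exact ((hg.contDiffAt (hS.mem_nhds hp)).isSymmSndFDerivAt
    (by simpa using WithTop.coe_le_coe.2 (le_top : (2 : ℕ∞) ≤ ⊤))).eq _ _

theorem pd_iterate_comm {m : ℕ} {S : Set (Fin m → ℝ)} (hS : IsOpen S) {g : (Fin m → ℝ) → ℝ}
    (hg : ContDiffOn ℝ ∞ g S) (r s : Fin m) (j : ℕ) {p : Fin m → ℝ} (hp : p ∈ S) :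
    pd r ((pd s)^[j] g) p = (pd s)^[j] (pd r g) p := by
  induction j generalizing p with
  | zero => rfl
  | succ j ih =>
    rw [Function.iterate_succ_apply', Function.iterate_succ_apply',
      pd_comm hS (contDiffOn_iterate_pd hS hg s j) r s hp]
    exact pd_congr hS (fun q hq => ih hq) s hp

theorem pd_add {m : ℕ} {g h : (Fin m → ℝ) → ℝ} {p : Fin m → ℝ} (hg : DifferentiableAt ℝ g p)
    (hh : DifferentiableAt ℝ h p) (r : Fin m) :
    pd r (fun q => g q + h q) p = pd r g p + pd r h p := by
  unfold pd; rw [fderiv_fun_add hg hh]; simp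

theorem pd_sub {m : ℕ} {g h : (Fin m → ℝ) → ℝ} {p : Fin m → ℝ} (hg : DifferentiableAt ℝ g p)
    (hh : DifferentiableAt ℝ h p) (r : Fin m) :
    pd r (fun q => g q - h q) p = pd r g p - pd r h p := by
  unfold pd; rw [fderiv_fun_sub hg hh]; simp

theorem pd_mul {m : ℕ} {g h : (Fin m → ℝ) → ℝ} {p : Fin m → ℝ} (hg : DifferentiableAt ℝ g p)
    (hh : DifferentiableAt ℝ h p) (r : Fin m) :
    pd r (fun q => g q * h q) p = g p * pd r h p + pd r g p * h p := by
  unfold pd; rw [fderiv_fun_mul hg hh]; simp [mul_comm]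

theorem pd_cos {m : ℕ} {g : (Fin m → ℝ) → ℝ} {p : Fin m → ℝ} (hg : DifferentiableAt ℝ g p)
    (r : Fin m) : pd r (fun q => Real.cos (g q)) p = -Real.sin (g p) * pd r g p := by
  unfold pd; rw [fderiv_cos hg]; simp

theorem pd_sin {m : ℕ} {g : (Fin m → ℝ) → ℝ} {p : Fin m → ℝ} (hg : DifferentiableAt ℝ g p)
    (r : Fin m) : pd r (fun q => Real.sin (g q)) p = Real.cos (g p) * pd r g p := by
  unfold pd; rw [fderiv_sin hg]; simp

theorem pd_sum {m : ℕ} {ι : Type*} (s : Finset ι) {g : ι → (Fin m → ℝ) → ℝ} {p : Fin m → ℝ}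
    (hg : ∀ i ∈ s, DifferentiableAt ℝ (g i) p) (r : Fin m) :
    pd r (fun q => ∑ i ∈ s, g i q) p = ∑ i ∈ s, pd r (g i) p := by
  unfold pd; rw [fderiv_fun_sum hg]; simp

theorem pd_comp {m : ℕ} {Υ : (Fin m → ℝ) → (Fin m → ℝ)} {g : (Fin m → ℝ) → ℝ} {p : Fin m → ℝ}
    (hg : DifferentiableAt ℝ g (Υ p)) (hΥ : DifferentiableAt ℝ Υ p) (r : Fin m) :
    pd r (fun q => g (Υ q)) p = ∑ c, pd c g (Υ p) * pd r (fun q => Υ q c) p := by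
  have h1 : ∀ c, pd r (fun q => Υ q c) p = fderiv ℝ Υ p (Pi.single r 1) c := by
    intro c
    unfold pd
    rw [fderiv_apply hΥ]
    rfl
  have h2 : pd r (fun q => g (Υ q)) p = fderiv ℝ g (Υ p) (fderiv ℝ Υ p (Pi.single r 1)) := by
    unfold pd
    rw [show (fun q => g (Υ q)) = g ∘ Υ from rfl, fderiv_comp p hg hΥ]
    rfl
  rw [h2, pi_eq_sum_univ' (fderiv ℝ Υ p (Pi.single r 1)), map_sum]
  refine Finset.sum_congr rfl fun c _ => ?_
  rw [map_smul, h1, smul_eq_mul, mul_comm]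
  rfl

/-! ### Differential functions evaluated on a function -/

/-- The first `N` independent variables and the first `N` jet coordinates. -/
def Jet.trunc (N : ℕ) (z : Jet) : (Fin N → ℝ) × (Fin N → ℝ) :=
  (fun i => z.y i, fun i => z.u i)

/-- The `a`-th standard basis vector of `ℝ^N`, zero if `a ≥ N`. -/
def stdVec (N a : ℕ) : Fin N → ℝ := fun i => if (i : ℕ) = a then 1 else 0

theorem hasDerivAt_update (N : ℕ) (x : ℕ → ℝ) (a : ℕ) :
    HasDerivAt (fun s => (fun i : Fin N => Function.update x a s i)) (stdVec N a) (x a) := by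
  rw [hasDerivAt_pi]
  intro i
  by_cases h : (i : ℕ) = a
  · subst h
    simp only [stdVec, Function.update_self, if_true]
    exact hasDerivAt_id _
  · simpa [stdVec, h] using hasDerivAt_const (x a) (x i)

section

variable {P : Jet → ℝ} {N : ℕ} {f : (Fin N → ℝ) × (Fin N → ℝ) → ℝ}

theorem baseDeriv_eq (hf : ContDiff ℝ ∞ f) (hP : ∀ z, P z = f (z.trunc N)) (a : ℕ) (z : Jet) :
    baseDeriv a P z = fderiv ℝ f (z.trunc N) (stdVec N a, 0) := by
  have h := (hasDerivAt_update N z.y a).prodMk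
    (hasDerivAt_const (z.y a) (fun i : Fin N => z.u i))
  have hfd : HasFDerivAt f (fderiv ℝ f (z.trunc N))
      (fun i : Fin N => Function.update z.y a (z.y a) i, fun i : Fin N => z.u i) := by
    have := (hf.differentiable (by simp) (z.trunc N)).hasFDerivAt
    simpa [Jet.trunc] using this
  have := hfd.comp_hasDerivAt (z.y a) h
  unfold baseDeriv
  simp only [hP]
  exact this.deriv

theorem jetDeriv_eq (hf : ContDiff ℝ ∞ f) (hP : ∀ z, P z = f (z.trunc N)) (j : ℕ) (z : Jet) :
    jetDeriv j P z = fderiv ℝ f (z.trunc N) (0, stdVec N j) := by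
  have h := (hasDerivAt_const (z.u j) (fun i : Fin N => z.y i)).prodMk
    (hasDerivAt_update N z.u j)
  have hfd : HasFDerivAt f (fderiv ℝ f (z.trunc N))
      (fun i : Fin N => z.y i, fun i : Fin N => Function.update z.u j (z.u j) i) := by
    have := (hf.differentiable (by simp) (z.trunc N)).hasFDerivAt
    simpa [Jet.trunc] using this
  have := hfd.comp_hasDerivAt (z.u j) h
  unfold jetDeriv
  simp only [hP]
  exact this.deriv

/-- The coefficients `c` are arbitrary, so that `D_x` and the chain rule along any function are
instances. The sum stops at `N` because `f` sees no later jet coordinate. -/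
theorem baseDeriv_add_finsum (hf : ContDiff ℝ ∞ f) (hP : ∀ z, P z = f (z.trunc N)) (a : ℕ)
    (z : Jet) (c : ℕ → ℝ) :
    baseDeriv a P z + ∑ᶠ j : ℕ, c j * jetDeriv j P z =
      fderiv ℝ f (z.trunc N) (stdVec N a, fun i => c i) := by
  have hs : (Function.support fun j => c j * jetDeriv j P z) ⊆ Finset.range N := by
    intro j hj
    by_contra hjN
    apply hj
    have : stdVec N j = 0 := by
      ext i
      have : (i : ℕ) ≠ j := by
        have := i.2
        simp at hjN
        omega
      simp [stdVec, this]
    simp only [jetDeriv_eq hf hP, this]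
    rw [← Prod.zero_eq_mk, map_zero, mul_zero]
  rw [finsum_eq_sum_of_support_subset _ hs, baseDeriv_eq hf hP, Finset.sum_range]
  simp only [jetDeriv_eq hf hP]
  have : (stdVec N a, fun i : Fin N => c i) =
      ((stdVec N a, 0) : (Fin N → ℝ) × (Fin N → ℝ)) + ∑ i : Fin N, c i • (0, stdVec N i) := by
    refine Prod.ext ?_ ?_
    · simp [Prod.fst_sum]
    · ext k
      simp [Prod.snd_sum, stdVec, Fin.val_inj]
  rw [this, map_add, map_sum]
  simp only [map_smul, smul_eq_mul]

theorem totalX_eq (hf : ContDiff ℝ ∞ f) (hP : ∀ z, P z = f (z.trunc N)) (z : Jet) :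
    totalX P z = fderiv ℝ f (z.trunc N) (stdVec N 0, fun i => z.u (i + 1)) :=
  baseDeriv_add_finsum hf hP 0 z fun j => z.u (j + 1)

end

theorem IsDifferentialFunction.totalX {P : Jet → ℝ} (hP : IsDifferentialFunction P) :
    IsDifferentialFunction (totalX P) := by
  obtain ⟨N, f, hf, hPf⟩ := hP
  -- `D_x` brings in one further jet coordinate, `u_{x^N}`, hence `N + 1`.
  refine ⟨N + 1, fun q => fderiv ℝ f (fun i => q.1 i.castSucc, fun i => q.2 i.castSucc)
    (stdVec N 0, fun i => q.2 i.succ), ?_, fun z => ?_⟩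
  · refine ContDiff.clm_apply ?_ ?_
    · refine (hf.fderiv_right (m := ∞) (by simp)).comp ?_
      fun_prop
    · fun_prop
  · rw [totalX_eq hf hPf]
    simp [Jet.trunc]

theorem IsDifferentialFunction.iterate_totalX {P : Jet → ℝ} (hP : IsDifferentialFunction P)
    (j : ℕ) : IsDifferentialFunction (PSS.totalX^[j] P) := by
  induction j with
  | zero => exact hP
  | succ j ih => rw [Function.iterate_succ_apply']; exact ih.totalX

theorem contDiff_extendByZero (m k : ℕ) :
    ContDiff ℝ ∞ (fun p : Fin m → ℝ => extendByZero p k) := by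
  unfold extendByZero
  by_cases h : k < m
  · simp only [h, dite_true]
    fun_prop
  · simp only [h, dite_false]
    exact contDiff_const

theorem pd_extendByZero {m : ℕ} (r : Fin m) (k : ℕ) (p : Fin m → ℝ) :
    pd r (fun q : Fin m → ℝ => extendByZero q k) p = if k = r then 1 else 0 := by
  unfold extendByZero pd
  by_cases h : k < m
  · simp only [h, dite_true]
    rw [(hasFDerivAt_apply (𝕜 := ℝ) (⟨k, h⟩ : Fin m) p).fderiv]
    simp [Pi.single_apply, Fin.ext_iff]
  · have : k ≠ r := by
      have := r.2
      omega
    simp [h, this]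

section

variable {n : ℕ} {S : Set (Fin (n + 2) → ℝ)} {g : (Fin (n + 2) → ℝ) → ℝ}

theorem contDiffOn_trunc_jet (hS : IsOpen S) (hg : ContDiffOn ℝ ∞ g S) (N : ℕ) :
    ContDiffOn ℝ ∞ (fun p => (jet g p).trunc N) S := by
  refine ContDiffOn.prodMk ?_ ?_
  · exact contDiffOn_pi.2 fun i => (contDiff_extendByZero _ _).contDiffOn
  · exact contDiffOn_pi.2 fun i => contDiffOn_iterate_pd hS hg 0 i

theorem IsDifferentialFunction.contDiffOn {P : Jet → ℝ} (hP : IsDifferentialFunction P)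
    (hS : IsOpen S) (hg : ContDiffOn ℝ ∞ g S) : ContDiffOn ℝ ∞ (fun p => P (jet g p)) S := by
  obtain ⟨N, f, hf, hPf⟩ := hP
  simp only [hPf]
  exact hf.comp_contDiffOn (contDiffOn_trunc_jet hS hg N)

/-- The plain chain rule: `g` need not solve any equation. This generality is needed later for `û`,
whose equation is the thing to be proved. -/
theorem IsDifferentialFunction.pd_jet {P : Jet → ℝ} (hP : IsDifferentialFunction P)
    (hS : IsOpen S) (hg : ContDiffOn ℝ ∞ g S) (r : Fin (n + 2)) {p : Fin (n + 2) → ℝ}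
    (hp : p ∈ S) :
    pd r (fun q => P (jet g q)) p = baseDeriv r P (jet g p) +
      ∑ᶠ j : ℕ, pd r ((pd 0)^[j] g) p * jetDeriv j P (jet g p) := by
  obtain ⟨N, f, hf, hPf⟩ := hP
  rw [baseDeriv_add_finsum hf hPf]
  have hd := differentiableAt_of_contDiffOn hS (contDiffOn_trunc_jet hS hg N) hp
  have hfd : DifferentiableAt ℝ f ((jet g p).trunc N) := hf.differentiable (by simp) _
  have : fderiv ℝ (fun q => P (jet g q)) p =
      (fderiv ℝ f ((jet g p).trunc N)).comp (fderiv ℝ (fun q => (jet g q).trunc N) p) := by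
    rw [← fderiv_comp p hfd hd]
    congr 1
    ext q
    exact hPf _
  rw [pd, this, ContinuousLinearMap.comp_apply]
  congr 1
  have h1 : DifferentiableAt ℝ (fun q => ((jet g q).trunc N).1) p := hd.fst
  have h2 : DifferentiableAt ℝ (fun q => ((jet g q).trunc N).2) p := hd.snd
  have h3 := (h1.hasFDerivAt.prodMk h2.hasFDerivAt).fderiv
  rw [show (fun q => (jet g q).trunc N) =
    fun q => (((jet g q).trunc N).1, ((jet g q).trunc N).2) from rfl, h3]
  refine Prod.ext ?_ ?_
  · ext i
    have := pd_extendByZero r i p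
    rw [pd] at this
    have h4 : fderiv ℝ (fun q => ((jet g q).trunc N).1 i) p (Pi.single r 1) =
      if (i : ℕ) = r then 1 else 0 := this
    rw [fderiv_apply h1] at h4
    exact h4
  · ext i
    have h4 : pd r ((pd 0)^[i] g) p =
      fderiv ℝ (fun q => ((jet g q).trunc N).2 i) p (Pi.single r 1) := rfl
    rw [fderiv_apply h2] at h4
    exact h4.symm

theorem pd_zero_jet {P : Jet → ℝ} (hP : IsDifferentialFunction P)
    (hS : IsOpen S) (hg : ContDiffOn ℝ ∞ g S) {p : Fin (n + 2) → ℝ} (hp : p ∈ S) :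
    pd 0 (fun q => P (jet g q)) p = totalX P (jet g p) := by
  rw [hP.pd_jet hS hg 0 hp]
  have : ∀ j, pd 0 ((pd 0)^[j] g) p = (jet g p).u (j + 1) := fun j => by
    simp only [jet, Function.iterate_succ_apply']
  simp only [this]
  rfl

theorem iterate_pd_zero_jet {P : Jet → ℝ} (hP : IsDifferentialFunction P)
    (hS : IsOpen S) (hg : ContDiffOn ℝ ∞ g S) (j : ℕ) {p : Fin (n + 2) → ℝ} (hp : p ∈ S) :
    (pd 0)^[j] (fun q => P (jet g q)) p = (totalX^[j] P) (jet g p) := by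
  induction j generalizing p with
  | zero => rfl
  | succ j ih =>
    rw [Function.iterate_succ_apply', Function.iterate_succ_apply',
      ← pd_zero_jet (hP.iterate_totalX j) hS hg hp]
    exact pd_congr hS (fun q hq => ih hq) 0 hp

/-- On a solution of `u_{τ_i} = F_i`, the total derivatives of a differential function are the
partial derivatives of its values. -/
theorem pd_jet_of_equation {F : ℕ → Jet → ℝ} (hF : ∀ i, IsDifferentialFunction (F i))
    (hS : IsOpen S) (hg : ContDiffOn ℝ ∞ g S)
    (heq : ∀ i : Fin (n + 1), ∀ p ∈ S, pd i.succ g p = F i (jet g p))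
    {P : Jet → ℝ} (hP : IsDifferentialFunction P) (r : Fin (n + 2)) {p : Fin (n + 2) → ℝ}
    (hp : p ∈ S) :
    pd r (fun q => P (jet g q)) p = total F r P (jet g p) := by
  induction r using Fin.cases with
  | zero => exact pd_zero_jet hP hS hg hp
  | succ i =>
    rw [hP.pd_jet hS hg i.succ hp]
    have : ∀ j, pd i.succ ((pd 0)^[j] g) p = (totalX^[j] (F i)) (jet g p) := fun j => by
      rw [pd_iterate_comm hS hg _ _ j hp, ← iterate_pd_zero_jet (hF i) hS hg j hp]
      exact iterate_pd_congr hS (heq i) 0 j hp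
    simp only [this]
    rfl

end

/-! ### One-forms and the structure equations -/

/-- The coefficients of the exterior derivative of the one-form `∑ A_r dy_r`. -/
noncomputable def curl {m : ℕ} (A : Fin m → (Fin m → ℝ) → ℝ) (p : Fin m → ℝ) (r s : Fin m) : ℝ :=
  pd r (A s) p - pd s (A r) p

/-- The coefficients of the wedge product of two one-forms. -/
noncomputable def wedge {m : ℕ} (A B : Fin m → (Fin m → ℝ) → ℝ) (p : Fin m → ℝ) (r s : Fin m) : ℝ :=
  A r p * B s p - A s p * B r p

/-- The structure equations of a metric of curvature `-1`. -/
structure StructureEquations {m : ℕ} (η : Fin 3 → Fin m → (Fin m → ℝ) → ℝ)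
    (S : Set (Fin m → ℝ)) : Prop where
  eq₁ : ∀ p ∈ S, ∀ r s, curl (η 0) p r s = wedge (η 2) (η 1) p r s
  eq₂ : ∀ p ∈ S, ∀ r s, curl (η 1) p r s = wedge (η 0) (η 2) p r s
  eq₃ : ∀ p ∈ S, ∀ r s, curl (η 2) p r s = wedge (η 0) (η 1) p r s

/-- The one-forms `Θ_α`, evaluated on a function. -/
noncomputable def evalForms {n : ℕ} (θ : Fin 3 → ℕ → Jet → ℝ) (g : (Fin (n + 2) → ℝ) → ℝ) :
    Fin 3 → Fin (n + 2) → (Fin (n + 2) → ℝ) → ℝ :=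
  fun α r p => θ α r (jet g p)

/-- The coframe `η₁, η₂` rotated by the angle `μ`, with its connection form. -/
noncomputable def rotForms {m : ℕ} (η : Fin 3 → Fin m → (Fin m → ℝ) → ℝ) (μ : (Fin m → ℝ) → ℝ) :
    Fin 3 → Fin m → (Fin m → ℝ) → ℝ :=
  ![fun r p => η 0 r p * Real.cos (μ p) + η 1 r p * Real.sin (μ p),
    fun r p => η 1 r p * Real.cos (μ p) - η 0 r p * Real.sin (μ p),
    fun r p => η 2 r p + pd r μ p]

/-- The pull-back of a one-form. -/
noncomputable def pull {m : ℕ} (Υ : (Fin m → ℝ) → (Fin m → ℝ)) (A : Fin m → (Fin m → ℝ) → ℝ) :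
    Fin m → (Fin m → ℝ) → ℝ :=
  fun r p => ∑ c, A c (Υ p) * pd r (fun q => Υ q c) p

theorem curl_congr {m : ℕ} {S : Set (Fin m → ℝ)} (hS : IsOpen S)
    {A B : Fin m → (Fin m → ℝ) → ℝ} (h : ∀ r, Set.EqOn (A r) (B r) S) {p : Fin m → ℝ}
    (hp : p ∈ S) (r s : Fin m) : curl A p r s = curl B p r s := by
  unfold curl
  rw [pd_congr hS (h s) r hp, pd_congr hS (h r) s hp]

theorem wedge_congr {m : ℕ} {S : Set (Fin m → ℝ)} {A B A' B' : Fin m → (Fin m → ℝ) → ℝ}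
    (hA : ∀ r, Set.EqOn (A r) (A' r) S) (hB : ∀ r, Set.EqOn (B r) (B' r) S) {p : Fin m → ℝ}
    (hp : p ∈ S) (r s : Fin m) : wedge A B p r s = wedge A' B' p r s := by
  unfold wedge
  rw [hA r hp, hA s hp, hB r hp, hB s hp]

theorem StructureEquations.congr {m : ℕ} {S : Set (Fin m → ℝ)} (hS : IsOpen S)
    {η η' : Fin 3 → Fin m → (Fin m → ℝ) → ℝ} (h : StructureEquations η S)
    (hη : ∀ α r, Set.EqOn (η' α r) (η α r) S) : StructureEquations η' S where
  eq₁ p hp r s := by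
    rw [curl_congr hS (hη 0) hp, wedge_congr (hη 2) (hη 1) hp, h.eq₁ p hp]
  eq₂ p hp r s := by
    rw [curl_congr hS (hη 1) hp, wedge_congr (hη 0) (hη 2) hp, h.eq₂ p hp]
  eq₃ p hp r s := by
    rw [curl_congr hS (hη 2) hp, wedge_congr (hη 0) (hη 1) hp, h.eq₃ p hp]

/-- On a solution, total derivatives become partial derivatives, so the identities for `d_H` on jet
space turn into identities for `d`. -/
theorem structureEquations_evalForms {n : ℕ} {F : ℕ → Jet → ℝ} {θ : Fin 3 → ℕ → Jet → ℝ}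
    (hF : IsPSSHierarchy F θ) {S : Set (Fin (n + 2) → ℝ)} (hS : IsOpen S)
    {g : (Fin (n + 2) → ℝ) → ℝ} (hg : ContDiffOn ℝ ∞ g S)
    (heq : ∀ i : Fin (n + 1), ∀ p ∈ S, pd i.succ g p = F i (jet g p)) :
    StructureEquations (evalForms θ g) S := by
  have key : ∀ α, ∀ p ∈ S, ∀ r s, curl (evalForms θ g α) p r s =
      total F r (θ α s) (jet g p) - total F s (θ α r) (jet g p) := by
    intro α p hp r s
    rw [← pd_jet_of_equation hF.diff_F hS hg heq (hF.diff_θ α s) r hp,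
      ← pd_jet_of_equation hF.diff_F hS hg heq (hF.diff_θ α r) s hp]
    rfl
  exact ⟨fun p hp r s => (key 0 p hp r s).trans (hF.struct₁ r s _),
    fun p hp r s => (key 1 p hp r s).trans (hF.struct₂ r s _),
    fun p hp r s => (key 2 p hp r s).trans (hF.struct₃ r s _)⟩

/-- Differentiating the rotated coframe produces terms in `dμ ∧ η_α`, which the summand `dμ` of the
new connection form absorbs. In the third equation `d(dμ) = 0`, and the area form is unchanged
because `sin² + cos² = 1`. -/
theorem StructureEquations.rotForms {m : ℕ} {S : Set (Fin m → ℝ)} (hS : IsOpen S)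
    {η : Fin 3 → Fin m → (Fin m → ℝ) → ℝ} (h : StructureEquations η S)
    (hη : ∀ α r, ContDiffOn ℝ ∞ (η α r) S) {μ : (Fin m → ℝ) → ℝ} (hμ : ContDiffOn ℝ ∞ μ S) :
    StructureEquations (rotForms η μ) S := by
  have dη : ∀ α r, ∀ p ∈ S, DifferentiableAt ℝ (η α r) p := fun α r p hp =>
    differentiableAt_of_contDiffOn hS (hη α r) hp
  have dμ : ∀ p ∈ S, DifferentiableAt ℝ μ p := fun p hp => differentiableAt_of_contDiffOn hS hμ hp
  have e0 : ∀ p ∈ S, ∀ r s, pd r (PSS.rotForms η μ 0 s) p =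
      pd r (η 0 s) p * Real.cos (μ p) - η 0 s p * Real.sin (μ p) * pd r μ p +
        (pd r (η 1 s) p * Real.sin (μ p) + η 1 s p * Real.cos (μ p) * pd r μ p) := by
    intro p hp r s
    refine (pd_add ((dη 0 s p hp).fun_mul (dμ p hp).cos) ((dη 1 s p hp).fun_mul (dμ p hp).sin) r).trans ?_
    rw [pd_mul (dη 0 s p hp) (dμ p hp).cos, pd_mul (dη 1 s p hp) (dμ p hp).sin,
      pd_cos (dμ p hp), pd_sin (dμ p hp)]
    ring
  have e1 : ∀ p ∈ S, ∀ r s, pd r (PSS.rotForms η μ 1 s) p =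
      pd r (η 1 s) p * Real.cos (μ p) - η 1 s p * Real.sin (μ p) * pd r μ p -
        (pd r (η 0 s) p * Real.sin (μ p) + η 0 s p * Real.cos (μ p) * pd r μ p) := by
    intro p hp r s
    refine (pd_sub ((dη 1 s p hp).fun_mul (dμ p hp).cos) ((dη 0 s p hp).fun_mul (dμ p hp).sin) r).trans ?_
    rw [pd_mul (dη 1 s p hp) (dμ p hp).cos, pd_mul (dη 0 s p hp) (dμ p hp).sin,
      pd_cos (dμ p hp), pd_sin (dμ p hp)]
    ring
  have e2 : ∀ p ∈ S, ∀ r s, pd r (PSS.rotForms η μ 2 s) p =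
      pd r (η 2 s) p + pd r (pd s μ) p := fun p hp r s =>
    pd_add (dη 2 s p hp) (differentiableAt_of_contDiffOn hS (contDiffOn_pd hS hμ s) hp) r
  have v0 : ∀ p r, PSS.rotForms η μ 0 r p =
    η 0 r p * Real.cos (μ p) + η 1 r p * Real.sin (μ p) := fun p r => rfl
  have v1 : ∀ p r, PSS.rotForms η μ 1 r p =
    η 1 r p * Real.cos (μ p) - η 0 r p * Real.sin (μ p) := fun p r => rfl
  have v2 : ∀ p r, PSS.rotForms η μ 2 r p = η 2 r p + pd r μ p := fun p r => rfl
  refine ⟨fun p hp r s => ?_, fun p hp r s => ?_, fun p hp r s => ?_⟩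
  all_goals
    have h1 := h.eq₁ p hp r s
    have h2 := h.eq₂ p hp r s
    have h3 := h.eq₃ p hp r s
    unfold curl wedge at h1 h2 h3 ⊢
  · rw [e0 p hp, e0 p hp, v2, v2, v1, v1]
    linear_combination Real.cos (μ p) * h1 + Real.sin (μ p) * h2
  · rw [e1 p hp, e1 p hp, v2, v2, v0, v0]
    linear_combination Real.cos (μ p) * h2 - Real.sin (μ p) * h1
  · rw [e2 p hp, e2 p hp, v0, v0, v1, v1, pd_comm hS hμ r s hp]
    linear_combination h3 - (η 0 r p * η 1 s p - η 0 s p * η 1 r p) *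
      Real.sin_sq_add_cos_sq (μ p)

/-! ### Pull-back of one-forms and descent of the structure equations -/

theorem mul_mul_transpose_apply {m : ℕ} (J M : Matrix (Fin m) (Fin m) ℝ) (r s : Fin m) :
    (J * M * J.transpose) r s = ∑ c, ∑ d, J r d * M d c * J s c := by
  simp [Matrix.mul_apply, Finset.sum_mul]

theorem differentiableAt_component {m : ℕ} {Υ : (Fin m → ℝ) → (Fin m → ℝ)} {p : Fin m → ℝ}
    (hΥ : DifferentiableAt ℝ Υ p) (c : Fin m) : DifferentiableAt ℝ (fun q => Υ q c) p :=
  differentiableAt_pi.1 hΥ c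

theorem contDiffOn_component {m : ℕ} {S : Set (Fin m → ℝ)} {Υ : (Fin m → ℝ) → (Fin m → ℝ)}
    (hΥ : ContDiffOn ℝ ∞ Υ S) (c : Fin m) : ContDiffOn ℝ ∞ (fun q => Υ q c) S :=
  contDiffOn_pi.1 hΥ c

/-- The exterior derivative commutes with pull-back. Rows of `jac` index the variables of
differentiation, so a two-form with matrix `M` pulls back to `J M Jᵀ`. -/
theorem curl_pull {m : ℕ} {S T : Set (Fin m → ℝ)} (hS : IsOpen S) (hT : IsOpen T)
    {Υ : (Fin m → ℝ) → (Fin m → ℝ)} (hΥ : ContDiffOn ℝ ∞ Υ S) (hST : Set.MapsTo Υ S T)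
    {A : Fin m → (Fin m → ℝ) → ℝ} (hA : ∀ c, ContDiffOn ℝ ∞ (A c) T) {p : Fin m → ℝ}
    (hp : p ∈ S) (r s : Fin m) :
    curl (pull Υ A) p r s = (jac Υ p * Matrix.of (curl A (Υ p)) * (jac Υ p).transpose) r s := by
  have dΥ := differentiableAt_of_contDiffOn hS hΥ hp
  have dA : ∀ c, DifferentiableAt ℝ (A c) (Υ p) := fun c =>
    differentiableAt_of_contDiffOn hT (hA c) (hST hp)
  have key : ∀ r s, pd r (pull Υ A s) p =
      ∑ c, (A c (Υ p) * pd r (pd s fun q => Υ q c) p) +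
        ∑ c, ∑ d, jac Υ p r d * pd d (A c) (Υ p) * jac Υ p s c := by
    intro r s
    have d1 : ∀ c, DifferentiableAt ℝ (fun q => A c (Υ q)) p := fun c => (dA c).comp p dΥ
    have d2 : ∀ c, DifferentiableAt ℝ (pd s fun q => Υ q c) p := fun c =>
      differentiableAt_of_contDiffOn hS (contDiffOn_pd hS (contDiffOn_component hΥ c) s) hp
    refine (pd_sum _ (fun c _ => (d1 c).mul (d2 c)) r).trans ?_
    rw [← Finset.sum_add_distrib]
    refine Finset.sum_congr rfl fun c _ => ?_
    refine (pd_mul (d1 c) (d2 c) r).trans ?_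
    rw [pd_comp (dA c) dΥ, Finset.sum_mul]
    congr 1
    refine Finset.sum_congr rfl fun d _ => ?_
    simp only [jac, Matrix.of_apply]
    ring
  rw [mul_mul_transpose_apply, curl, key, key]
  -- Second derivatives of `Υ` are symmetric, so they drop out of the curl.
  have hcomm : ∀ c, pd r (pd s fun q => Υ q c) p = pd s (pd r fun q => Υ q c) p := fun c =>
    pd_comm hS (contDiffOn_component hΥ c) r s hp
  simp only [hcomm, curl, Matrix.of_apply, mul_sub, sub_mul, Finset.sum_sub_distrib]
  rw [add_sub_add_left_eq_sub]
  congr 1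
  rw [Finset.sum_comm]
  refine Finset.sum_congr rfl fun c _ => Finset.sum_congr rfl fun d _ => ?_
  ring

theorem wedge_pull {m : ℕ} (Υ : (Fin m → ℝ) → (Fin m → ℝ)) (A B : Fin m → (Fin m → ℝ) → ℝ)
    (p : Fin m → ℝ) (r s : Fin m) :
    wedge (pull Υ A) (pull Υ B) p r s =
      (jac Υ p * Matrix.of (wedge A B (Υ p)) * (jac Υ p).transpose) r s := by
  rw [mul_mul_transpose_apply]
  simp only [wedge, Matrix.of_apply, mul_sub, sub_mul, Finset.sum_sub_distrib, pull]
  rw [Finset.sum_mul_sum, Finset.sum_mul_sum, Finset.sum_comm]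
  congr 1
  · refine Finset.sum_congr rfl fun c _ => Finset.sum_congr rfl fun d _ => ?_
    simp only [jac, Matrix.of_apply]
    ring
  · refine Finset.sum_congr rfl fun c _ => Finset.sum_congr rfl fun d _ => ?_
    simp only [jac, Matrix.of_apply]
    ring

theorem congruence_cancel {m : ℕ} {J M N : Matrix (Fin m) (Fin m) ℝ} (hJ : J.det ≠ 0)
    (h : J * M * J.transpose = J * N * J.transpose) : M = N := by
  have hu : IsUnit J := (Matrix.isUnit_iff_isUnit_det J).2 hJ.isUnit
  have hu' : IsUnit J.transpose := (Matrix.isUnit_transpose J).2 hu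
  exact hu.mul_left_cancel (hu'.mul_right_cancel h)

/-- The structure equations descend along a submersive pull-back. -/
theorem StructureEquations.of_pull {m : ℕ} {S : Set (Fin m → ℝ)} (hS : IsOpen S)
    {Υ : (Fin m → ℝ) → (Fin m → ℝ)} (hΥ : ContDiffOn ℝ ∞ Υ S) (hT : IsOpen (Υ '' S))
    (hdet : ∀ p ∈ S, Del Υ p ≠ 0) {η : Fin 3 → Fin m → (Fin m → ℝ) → ℝ}
    (hη : ∀ α c, ContDiffOn ℝ ∞ (η α c) (Υ '' S))
    (h : StructureEquations (fun α => pull Υ (η α)) S) :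
    StructureEquations η (Υ '' S) := by
  have key : ∀ α β γ : Fin 3, ∀ p ∈ S,
      (∀ r s, curl (pull Υ (η α)) p r s = wedge (pull Υ (η β)) (pull Υ (η γ)) p r s) →
      ∀ r s, curl (η α) (Υ p) r s = wedge (η β) (η γ) (Υ p) r s := by
    intro α β γ p hp h r s
    have : Matrix.of (curl (η α) (Υ p)) = Matrix.of (wedge (η β) (η γ) (Υ p)) := by
      refine congruence_cancel (hdet p hp) ?_
      ext r s
      rw [← wedge_pull, ← h, curl_pull hS hT hΥ (Set.mapsTo_image _ _) (hη α) hp]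
    exact congrFun (congrFun this r) s
  refine ⟨?_, ?_, ?_⟩ <;> rintro _ ⟨p, hp, rfl⟩
  · exact key 0 2 1 p hp (h.eq₁ p hp)
  · exact key 1 0 2 p hp (h.eq₂ p hp)
  · exact key 2 0 1 p hp (h.eq₃ p hp)

/-- A function on which the one-forms of a strictly pseudo-spherical hierarchy satisfy the
structure equations solves the equations of the hierarchy. -/
theorem equation_of_structureEquations {n : ℕ} {F : ℕ → Jet → ℝ} {θ : Fin 3 → ℕ → Jet → ℝ}
    (hF : IsStrictPSSHierarchy F θ) {S : Set (Fin (n + 2) → ℝ)} (hS : IsOpen S)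
    {g : (Fin (n + 2) → ℝ) → ℝ} (hg : ContDiffOn ℝ ∞ g S)
    (h : StructureEquations (evalForms θ g) S) (i : Fin (n + 1)) {p : Fin (n + 2) → ℝ}
    (hp : p ∈ S) : pd i.succ g p = F i (jet g p) := by
  -- Only the `dx ∧ dτ_i` coefficient is compared. Its `∂_x` part agrees with `D_x` on every
  -- function, so the whole discrepancy lies in the `τ_i`-derivative of `f_{α1}`.
  have key : ∀ α, curl (evalForms θ g α) p 0 i.succ =
      total F 0 (θ α (i + 1)) (jet g p) - total F (i + 1) (θ α 0) (jet g p) →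
      (pd i.succ g p - F i (jet g p)) * jetDeriv 0 (θ α 0) (jet g p) = 0 := by
    intro α hα
    have h1 : pd 0 (evalForms θ g α i.succ) p = totalX (θ α (i + 1)) (jet g p) :=
      pd_zero_jet (hF.diff_θ α _) hS hg hp
    have h2 : pd i.succ (evalForms θ g α 0) p = baseDeriv (i + 1) (θ α 0) (jet g p) +
        pd i.succ g p * jetDeriv 0 (θ α 0) (jet g p) := by
      have := (hF.diff_θ α 0).pd_jet hS hg i.succ hp
      -- Only `j = 0` contributes, since `f_{α1}` contains no `x`-derivatives of `u`.
      rw [finsum_eq_single _ 0] at this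
      · exact this
      · intro j hj
        rw [hF.space_part α j (Nat.one_le_iff_ne_zero.2 hj), mul_zero]
    have h3 : totalTau F i (θ α 0) (jet g p) = baseDeriv (i + 1) (θ α 0) (jet g p) +
        F i (jet g p) * jetDeriv 0 (θ α 0) (jet g p) := by
      unfold totalTau
      rw [finsum_eq_single _ 0]
      · rfl
      · intro j hj
        rw [hF.space_part α j (Nat.one_le_iff_ne_zero.2 hj), mul_zero]
    simp only [curl, total] at hα
    rw [h1, h2, h3] at hα
    linear_combination -hα
  have k0 := key 0 ((h.eq₁ p hp 0 i.succ).trans (hF.struct₁ 0 (i + 1) _).symm)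
  have k1 := key 1 ((h.eq₂ p hp 0 i.succ).trans (hF.struct₂ 0 (i + 1) _).symm)
  have k2 := key 2 ((h.eq₃ p hp 0 i.succ).trans (hF.struct₃ 0 (i + 1) _).symm)
  by_contra hne
  have hne' := sub_ne_zero.2 hne
  have z0 := (mul_eq_zero.1 k0).resolve_left hne'
  have z1 := (mul_eq_zero.1 k1).resolve_left hne'
  have z2 := (mul_eq_zero.1 k2).resolve_left hne'
  exact hF.nondeg (jet g p) (by rw [z0, z1, z2]; norm_num)

/-! ### Local diffeomorphisms -/

section

variable {m : ℕ} {S : Set (Fin m → ℝ)} {Υ : (Fin m → ℝ) → (Fin m → ℝ)}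

theorem contDiffOn_of_isLocalDiffeomorphOn
    (h : IsLocalDiffeomorphOn 𝓘(ℝ, Fin m → ℝ) 𝓘(ℝ, Fin m → ℝ) ∞ Υ S) : ContDiffOn ℝ ∞ Υ S :=
  contMDiffOn_iff_contDiffOn.1 h.contMDiffOn

/-- Requiring `g q ∈ S` near `Υ p` is what makes the image open and lets `g` be compared with the
inverse on `S`. -/
theorem exists_local_inverse (hS : IsOpen S)
    (h : IsLocalDiffeomorphOn 𝓘(ℝ, Fin m → ℝ) 𝓘(ℝ, Fin m → ℝ) ∞ Υ S) {p : Fin m → ℝ}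
    (hp : p ∈ S) :
    ∃ g : (Fin m → ℝ) → (Fin m → ℝ), ContDiffAt ℝ ∞ g (Υ p) ∧ (∀ᶠ q in nhds p, g (Υ q) = q) ∧
      ∀ᶠ q in nhds (Υ p), g q ∈ S ∧ Υ (g q) = q := by
  have hp' := h ⟨p, hp⟩
  have hc : ContDiffAt ℝ ∞ hp'.localInverse (Υ p) :=
    contMDiffAt_iff_contDiffAt.1 hp'.localInverse_contMDiffAt
  refine ⟨hp'.localInverse, hc, hp'.localInverse_eventuallyEq_left, ?_⟩
  refine Filter.Eventually.and ?_ hp'.localInverse_eventuallyEq_right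
  refine hc.continuousAt.eventually_mem (hS.mem_nhds ?_)
  rwa [hp'.localInverse_left_inv hp'.localInverse_mem_target]

theorem isOpen_image_of_isLocalDiffeomorphOn (hS : IsOpen S)
    (h : IsLocalDiffeomorphOn 𝓘(ℝ, Fin m → ℝ) 𝓘(ℝ, Fin m → ℝ) ∞ Υ S) : IsOpen (Υ '' S) := by
  rw [isOpen_iff_mem_nhds]
  rintro _ ⟨p, hp, rfl⟩
  obtain ⟨g, -, -, hg⟩ := exists_local_inverse hS h hp
  filter_upwards [hg] with q hq
  exact ⟨g q, hq.1, hq.2⟩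

/-- Injectivity on `S` forces the chosen global inverse to coincide with the smooth local inverse
near each point of the image. -/
theorem contDiffOn_invFunOn (hS : IsOpen S)
    (h : IsLocalDiffeomorphOn 𝓘(ℝ, Fin m → ℝ) 𝓘(ℝ, Fin m → ℝ) ∞ Υ S) (hinj : Set.InjOn Υ S) :
    ContDiffOn ℝ ∞ (Function.invFunOn Υ S) (Υ '' S) := by
  rintro _ ⟨p, hp, rfl⟩
  obtain ⟨g, hgc, -, hg⟩ := exists_local_inverse hS h hp
  refine (hgc.congr_of_eventuallyEq ?_).contDiffWithinAt
  filter_upwards [hg] with q hq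
  have hq' : q ∈ Υ '' S := ⟨g q, hq.1, hq.2⟩
  exact hinj (Function.invFunOn_mem hq') hq.1 ((Function.invFunOn_eq hq').trans hq.2.symm)

theorem exists_injOn_nhds (hS : IsOpen S)
    (h : IsLocalDiffeomorphOn 𝓘(ℝ, Fin m → ℝ) 𝓘(ℝ, Fin m → ℝ) ∞ Υ S) {p : Fin m → ℝ}
    (hp : p ∈ S) : ∃ t ∈ nhds p, Set.InjOn Υ t := by
  obtain ⟨g, -, hg, -⟩ := exists_local_inverse hS h hp
  refine ⟨_, hg, fun a ha b hb hab => ?_⟩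
  rw [← show g (Υ a) = a from ha, ← show g (Υ b) = b from hb, hab]

theorem Del_ne_zero (hS : IsOpen S)
    (h : IsLocalDiffeomorphOn 𝓘(ℝ, Fin m → ℝ) 𝓘(ℝ, Fin m → ℝ) ∞ Υ S) {p : Fin m → ℝ}
    (hp : p ∈ S) : Del Υ p ≠ 0 := by
  obtain ⟨g, hgc, hg, -⟩ := exists_local_inverse hS h hp
  have dΥ := differentiableAt_of_contDiffOn hS (contDiffOn_of_isLocalDiffeomorphOn h) hp
  have dg : DifferentiableAt ℝ g (Υ p) := hgc.differentiableAt (by simp)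
  -- The chain rule for `g ∘ Υ = id`; the order of the factors is reversed because `jac` is the
  -- transpose of the usual derivative matrix.
  have hmul : jac Υ p * jac g (Υ p) = 1 := by
    ext r c
    have h1 : pd r (fun q => g (Υ q) c) p = pd r (fun q => q c) p := by
      unfold pd
      rw [Filter.EventuallyEq.fderiv_eq]
      filter_upwards [hg] with q hq
      rw [hq]
    have h2 : pd r (fun q : Fin m → ℝ => q c) p = (1 : Matrix (Fin m) (Fin m) ℝ) r c := by
      unfold pd
      rw [(hasFDerivAt_apply (𝕜 := ℝ) c p).fderiv]
      simp [Pi.single_apply, Matrix.one_apply, eq_comm]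
    rw [← h2, ← h1, pd_comp (g := fun q => g q c) (differentiableAt_component dg c) dΥ,
      Matrix.mul_apply]
    refine Finset.sum_congr rfl fun d _ => ?_
    simp only [jac, Matrix.of_apply]
    ring
  intro h0
  have := congrArg Matrix.det hmul
  rw [Matrix.det_mul, Matrix.det_one, show (jac Υ p).det = 0 from h0, zero_mul] at this
  exact zero_ne_one this

end

/-! ### The function `w = û ∘ Υ` and its jet -/

theorem xhatDeriv_eq {n : ℕ} {S T : Set (Fin (n + 2) → ℝ)} (hS : IsOpen S) (hT : IsOpen T)
    {Υ : (Fin (n + 2) → ℝ) → (Fin (n + 2) → ℝ)} (hΥ : ContDiffOn ℝ ∞ Υ S)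
    (hST : Set.MapsTo Υ S T) (hdet : ∀ p ∈ S, Del Υ p ≠ 0)
    {w v : (Fin (n + 2) → ℝ) → ℝ} (hv : ContDiffOn ℝ ∞ v T) (hw : ∀ p ∈ S, w p = v (Υ p))
    {p : Fin (n + 2) → ℝ} (hp : p ∈ S) : xhatDeriv Υ w p = pd 0 v (Υ p) := by
  have h : (fun r => pd r w p) = (jac Υ p).mulVec fun c => pd c v (Υ p) := by
    ext r
    rw [pd_congr hS hw r hp, pd_comp (differentiableAt_of_contDiffOn hT hv (hST hp))
      (differentiableAt_of_contDiffOn hS hΥ hp)]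
    simp only [Matrix.mulVec, dotProduct, jac, Matrix.of_apply]
    exact Finset.sum_congr rfl fun c _ => mul_comm _ _
  rw [xhatDeriv, h, Matrix.mulVec_mulVec, Matrix.nonsing_inv_mul _ (hdet p hp).isUnit,
    Matrix.one_mulVec]

theorem iterate_xhatDeriv_eq {n : ℕ} {S T : Set (Fin (n + 2) → ℝ)} (hS : IsOpen S)
    (hT : IsOpen T) {Υ : (Fin (n + 2) → ℝ) → (Fin (n + 2) → ℝ)} (hΥ : ContDiffOn ℝ ∞ Υ S)
    (hST : Set.MapsTo Υ S T) (hdet : ∀ p ∈ S, Del Υ p ≠ 0)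
    {w v : (Fin (n + 2) → ℝ) → ℝ} (hv : ContDiffOn ℝ ∞ v T) (hw : ∀ p ∈ S, w p = v (Υ p))
    (j : ℕ) {p : Fin (n + 2) → ℝ} (hp : p ∈ S) :
    ((xhatDeriv Υ)^[j] w) p = ((pd 0)^[j] v) (Υ p) := by
  induction j generalizing p with
  | zero => exact hw p hp
  | succ j ih =>
    rw [Function.iterate_succ_apply', Function.iterate_succ_apply']
    exact xhatDeriv_eq hS hT hΥ hST hdet (contDiffOn_iterate_pd hT hv 0 j) (fun q hq => ih hq) hp

/-- Translates the system, written in terms of `w` and `Υ` only, into statements about the jet of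
`û` on the image of `Υ`. -/
theorem hatJet_eq {n : ℕ} {S T : Set (Fin (n + 2) → ℝ)} (hS : IsOpen S)
    (hT : IsOpen T) {Υ : (Fin (n + 2) → ℝ) → (Fin (n + 2) → ℝ)} (hΥ : ContDiffOn ℝ ∞ Υ S)
    (hST : Set.MapsTo Υ S T) (hdet : ∀ p ∈ S, Del Υ p ≠ 0)
    {w v : (Fin (n + 2) → ℝ) → ℝ} (hv : ContDiffOn ℝ ∞ v T) (hw : ∀ p ∈ S, w p = v (Υ p))
    {p : Fin (n + 2) → ℝ} (hp : p ∈ S) : hatJet Υ w p = jet v (Υ p) := by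
  simp only [hatJet, jet, iterate_xhatDeriv_eq hS hT hΥ hST hdet hv hw _ hp]

/-! ### Inverting `G` -/

theorem injective_of_deriv_ne_zero {G : ℝ → ℝ} (hG : ContDiff ℝ ∞ G)
    (hG' : ∀ s, deriv G s ≠ 0) : Function.Injective G := by
  have key : ∀ a b, a < b → G a ≠ G b := fun a b hab he => by
    obtain ⟨c, -, hc⟩ := exists_deriv_eq_zero hab hG.continuous.continuousOn he
    exact hG' c hc
  intro a b he
  rcases lt_trichotomy a b with h | h | h
  · exact absurd he (key a b h)
  · exact h
  · exact absurd he.symm (key b a h)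

/-- Not even continuity of `w` is assumed: near `G (w p)` a smooth local inverse of `G` exists, and
global injectivity of `G` identifies its value at `G (w q)` with `w q`. -/
theorem contDiffOn_of_comp {G : ℝ → ℝ} (hG : ContDiff ℝ ∞ G)
    (hG' : ∀ s, deriv G s ≠ 0) {m : ℕ} {S : Set (Fin m → ℝ)} (hS : IsOpen S)
    {w : (Fin m → ℝ) → ℝ} (h : ContDiffOn ℝ ∞ (fun p => G (w p)) S) : ContDiffOn ℝ ∞ w S := by
  intro p hp
  have hd := (hG.differentiable (by simp) (w p)).hasDerivAt.hasFDerivAt_equiv (hG' (w p))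
  have hGa : ContDiffAt ℝ ∞ G (w p) := hG.contDiffAt
  have hinv := hGa.to_localInverse hd (by simp)
  have hS' := hS.mem_nhds hp
  have hcomp : ContDiffAt ℝ ∞ (fun q => hGa.localInverse hd (by simp) (G (w q))) p :=
    ContDiffAt.comp p hinv (h.contDiffAt hS')
  refine (hcomp.congr_of_eventuallyEq ?_).contDiffWithinAt
  have hr := (hGa.hasStrictFDerivAt' hd (by simp)).eventually_right_inverse
  filter_upwards [(h.contDiffAt hS').continuousAt.eventually hr] with q hq
  exact injective_of_deriv_ne_zero hG hG' hq.symm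

/-! ### The system -/

/-- Cramer's rule, used to read the determinant equations as the pull-back identity for the first
form. -/
theorem eq_of_cramer {m : ℕ} {A : Matrix (Fin m) (Fin m) ℝ} (hA : A.det ≠ 0) {a b : Fin m → ℝ} :
    A.mulVec a = b ↔ ∀ c, A.det * a c = (A.updateCol c b).det := by
  have hu : IsUnit A := (Matrix.isUnit_iff_isUnit_det A).2 hA.isUnit
  constructor
  · rintro rfl c
    have h : A.mulVec (A.cramer (A.mulVec a)) = A.mulVec (A.det • a) := by
      rw [Matrix.mulVec_cramer, Matrix.mulVec_smul]
    have := congrFun (Matrix.mulVec_injective_iff_isUnit.2 hu h) c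
    rw [Matrix.cramer_apply] at this
    rw [this, Pi.smul_apply, smul_eq_mul]
  · intro h
    have h1 : A.cramer b = A.det • a := by
      ext c
      rw [Matrix.cramer_apply, ← h c, Pi.smul_apply, smul_eq_mul]
    have h2 := Matrix.mulVec_cramer A b
    rw [h1, Matrix.mulVec_smul] at h2
    exact smul_right_injective _ hA h2

theorem contDiffOn_jac {m : ℕ} {S : Set (Fin m → ℝ)} (hS : IsOpen S)
    {Υ : (Fin m → ℝ) → (Fin m → ℝ)} (hΥ : ContDiffOn ℝ ∞ Υ S) (r c : Fin m) :
    ContDiffOn ℝ ∞ (fun p => jac Υ p r c) S :=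
  contDiffOn_pd hS (contDiffOn_component hΥ c) r

theorem contDiffOn_det {m k : ℕ} {S : Set (Fin m → ℝ)}
    {A : (Fin m → ℝ) → Matrix (Fin k) (Fin k) ℝ}
    (hA : ∀ r c, ContDiffOn ℝ ∞ (fun p => A p r c) S) : ContDiffOn ℝ ∞ (fun p => (A p).det) S := by
  simp only [Matrix.det_apply]
  exact ContDiffOn.sum fun σ _ => (contDiffOn_prod fun i _ => hA _ _).const_smul _

theorem contDiffOn_DelCol_div_Del {n : ℕ} {S : Set (Fin (n + 2) → ℝ)} (hS : IsOpen S)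
    {Υ : (Fin (n + 2) → ℝ) → (Fin (n + 2) → ℝ)} (hΥ : ContDiffOn ℝ ∞ Υ S)
    (hdet : ∀ p ∈ S, Del Υ p ≠ 0) {θ : Fin 3 → ℕ → Jet → ℝ}
    (hθ : ∀ α a, IsDifferentialFunction (θ α a)) {u μ : (Fin (n + 2) → ℝ) → ℝ}
    (hu : ContDiffOn ℝ ∞ u S) (hμ : ContDiffOn ℝ ∞ μ S) (c : Fin (n + 2)) :
    ContDiffOn ℝ ∞ (fun p => DelCol θ u Υ μ c p / Del Υ p) S := by
  refine ContDiffOn.div (contDiffOn_det fun r d => ?_) (contDiffOn_det (contDiffOn_jac hS hΥ)) hdet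
  by_cases hd : d = c
  · subst hd
    simp only [Matrix.updateCol_self, rotCol]
    exact (((hθ 0 r).contDiffOn hS hu).mul hμ.cos).add (((hθ 1 r).contDiffOn hS hu).mul hμ.sin)
  · simp only [Matrix.updateCol_ne hd]
    exact contDiffOn_jac hS hΥ r d

/-- The conclusion at one level `n`. -/
theorem exists_transformed_solution {n : ℕ} {F : ℕ → Jet → ℝ} {θ : Fin 3 → ℕ → Jet → ℝ}
    {Fh : ℕ → Jet → ℝ} {θh : Fin 3 → ℕ → Jet → ℝ}
    (hF : IsPSSHierarchy F θ) (hFh : IsStrictPSSHierarchy Fh θh)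
    {G : ℝ → ℝ} (hG : ContDiff ℝ ∞ G) (hG' : ∀ s, deriv G s ≠ 0)
    (hGf : ∀ z : Jet, θh 0 0 z = G (z.u 0))
    {S : Set (Fin (n + 2) → ℝ)} (hS : IsOpen S) {u μ : (Fin (n + 2) → ℝ) → ℝ}
    (hu : ContDiffOn ℝ ∞ u S)
    (heq : ∀ i : Fin (n + 1), ∀ p ∈ S, pd i.succ u p = F i (jet u p))
    {Υ : (Fin (n + 2) → ℝ) → (Fin (n + 2) → ℝ)}
    (hΥ : IsLocalDiffeomorphOn 𝓘(ℝ, Fin (n + 2) → ℝ) 𝓘(ℝ, Fin (n + 2) → ℝ) ∞ Υ S)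
    (hinj : Set.InjOn Υ S) (hμ : ContDiffOn ℝ ∞ μ S) (hsys : SolvesSystem θ θh G u S Υ μ) :
    ∃ v : (Fin (n + 2) → ℝ) → ℝ, ContDiffOn ℝ ∞ v (Υ '' S) ∧
      (∀ i : Fin (n + 1), ∀ q ∈ Υ '' S, pd i.succ v q = Fh i (jet v q)) ∧
      (∀ p ∈ S, G (v (Υ p)) = DelCol θ u Υ μ 0 p / Del Υ p) ∧
      ∀ α r, Set.EqOn (pull Υ (evalForms θh v α) r) (rotForms (evalForms θ u) μ α r) S := by
  obtain ⟨w, hw, h1, h2, h3⟩ := hsys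
  have hΥc := contDiffOn_of_isLocalDiffeomorphOn hΥ
  have hdet : ∀ p ∈ S, Del Υ p ≠ 0 := fun p hp => Del_ne_zero hS hΥ hp
  have hT := isOpen_image_of_isLocalDiffeomorphOn hS hΥ
  have hwc : ContDiffOn ℝ ∞ w S := by
    refine contDiffOn_of_comp hG hG' hS ?_
    exact (contDiffOn_DelCol_div_Del hS hΥc hdet hF.diff_θ hu hμ 0).congr hw
  have hinvmaps : Set.MapsTo (Function.invFunOn Υ S) (Υ '' S) S := fun q hq =>
    Function.invFunOn_mem hq
  -- This is `û = w ∘ Υ⁻¹`.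
  let v := fun q => w (Function.invFunOn Υ S q)
  have hvc : ContDiffOn ℝ ∞ v (Υ '' S) := hwc.comp (contDiffOn_invFunOn hS hΥ hinj) hinvmaps
  have hwv : ∀ p ∈ S, w p = v (Υ p) := fun p hp => by
    simp only [v, hinj.leftInvOn_invFunOn hp]
  have hjet : ∀ p ∈ S, hatJet Υ w p = jet v (Υ p) := fun p hp =>
    hatJet_eq hS hT hΥc (Set.mapsTo_image _ _) hdet hvc hwv hp
  have hpull : ∀ α r,
      Set.EqOn (pull Υ (evalForms θh v α) r) (rotForms (evalForms θ u) μ α r) S := by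
    intro α r p hp
    fin_cases α
    · have hcol : (jac Υ p).mulVec (fun c : Fin (n + 2) => θh 0 c (jet v (Υ p))) =
          rotCol θ u μ p := by
        refine (eq_of_cramer (hdet p hp)).2 fun c => ?_
        -- The system omits the first column; there the equation is the defining relation of `w`,
        -- through `f̂₁₁ = G(û)`.
        by_cases hc : c = 0
        · subst hc
          have : θh 0 ((0 : Fin (n + 2)) : ℕ) (jet v (Υ p)) = DelCol θ u Υ μ 0 p / Del Υ p := by
            rw [← hw p hp, hwv p hp]
            exact hGf _
          rw [this]
          exact mul_div_cancel₀ _ (hdet p hp)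
        · rw [← hjet p hp]
          exact h1 p hp c hc
      have := congrFun hcol r
      refine Eq.trans ?_ this
      exact Finset.sum_congr rfl fun c _ => mul_comm _ _
    · have := h2 p hp r
      rw [hjet p hp] at this
      exact this
    · have := h3 p hp r
      rw [hjet p hp] at this
      exact this
  refine ⟨v, hvc, fun i q hq => ?_, fun p hp => by rw [← hwv p hp, hw p hp], hpull⟩
  refine equation_of_structureEquations hFh hT hvc ?_ i hq
  refine StructureEquations.of_pull hS hΥc hT hdet
    (fun α c => (hFh.diff_θ α c).contDiffOn hT hvc) ?_
  refine StructureEquations.congr hS ?_ hpull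
  exact (structureEquations_evalForms hF hS hu heq).rotForms hS
    (fun α r => (hF.diff_θ α r).contDiffOn hS hu) hμ

/-! ### Restriction to the hyperplane `τ_{n+1} = 0` -/

/-- The embedding `p ↦ (p, 0)` of `ℝ^m` in `ℝ^{m+1}`. -/
noncomputable def snocL (m : ℕ) : (Fin m → ℝ) →L[ℝ] (Fin (m + 1) → ℝ) :=
  ContinuousLinearMap.pi fun i =>
    Fin.lastCases (motive := fun _ => (Fin m → ℝ) →L[ℝ] ℝ) 0
      (fun j => ContinuousLinearMap.proj j) i

theorem snocL_apply {m : ℕ} (p : Fin m → ℝ) : snocL m p = (Fin.snoc p 0 : Fin (m + 1) → ℝ) := by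
  ext i
  refine Fin.lastCases ?_ (fun j => ?_) i <;> simp [snocL]

theorem continuous_snoc (m : ℕ) :
    Continuous fun p : Fin m → ℝ => (Fin.snoc p 0 : Fin (m + 1) → ℝ) := by
  simp only [← snocL_apply]
  exact (snocL m).continuous

theorem snoc_injective (m : ℕ) :
    Function.Injective fun p : Fin m → ℝ => (Fin.snoc p 0 : Fin (m + 1) → ℝ) := fun _ _ h =>
  (Fin.snoc_inj.1 h).1

theorem pd_snoc {m : ℕ} {g : (Fin (m + 1) → ℝ) → ℝ} {p : Fin m → ℝ}
    (hg : DifferentiableAt ℝ g (Fin.snoc p 0 : Fin (m + 1) → ℝ)) (r : Fin m) :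
    pd r (fun q : Fin m → ℝ => g (Fin.snoc q 0 : Fin (m + 1) → ℝ)) p =
      pd r.castSucc g (Fin.snoc p 0 : Fin (m + 1) → ℝ) := by
  simp only [← snocL_apply] at hg ⊢
  unfold pd
  rw [show (fun q => g (snocL m q)) = g ∘ snocL m from rfl,
    fderiv_comp p hg (snocL m).differentiableAt, ContinuousLinearMap.fderiv,
    ContinuousLinearMap.comp_apply]
  congr 1
  ext i
  refine Fin.lastCases ?_ (fun j => ?_) i
  · simp [snocL]
  · simp [snocL, Pi.single_apply]

theorem pd_restrict {m : ℕ} {S : Set (Fin m → ℝ)} (hS : IsOpen S) {S' : Set (Fin (m + 1) → ℝ)}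
    (hS' : IsOpen S') (hSS : ∀ p ∈ S, (Fin.snoc p 0 : Fin (m + 1) → ℝ) ∈ S')
    {g : (Fin m → ℝ) → ℝ} {g' : (Fin (m + 1) → ℝ) → ℝ} (hg' : ContDiffOn ℝ ∞ g' S')
    (h : ∀ p ∈ S, g' (Fin.snoc p 0 : Fin (m + 1) → ℝ) = g p) (r : Fin m)
    {p : Fin m → ℝ} (hp : p ∈ S) :
    pd r.castSucc g' (Fin.snoc p 0 : Fin (m + 1) → ℝ) = pd r g p := by
  rw [← pd_snoc (differentiableAt_of_contDiffOn hS' hg' (hSS p hp))]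
  exact pd_congr hS h r hp

theorem extendByZero_snoc {m : ℕ} (p : Fin m → ℝ) :
    extendByZero (Fin.snoc p 0 : Fin (m + 1) → ℝ) = extendByZero p := by
  funext k
  unfold extendByZero
  by_cases h : k < m
  · rw [dif_pos h, dif_pos (Nat.lt_succ_of_lt h)]
    exact Fin.snoc_castSucc (α := fun _ => ℝ) 0 p ⟨k, h⟩
  · rw [dif_neg h]
    by_cases h' : k < m + 1
    · obtain rfl : k = m := by omega
      rw [dif_pos h']
      exact Fin.snoc_last (α := fun _ => ℝ) 0 p
    · rw [dif_neg h']

section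

variable {n : ℕ} {S : Set (Fin (n + 2) → ℝ)} {S' : Set (Fin (n + 1 + 2) → ℝ)}

/-- The `x`-direction is tangent to the hyperplane, and absent variables are read as `0` at both
levels. -/
theorem jet_restrict (hS : IsOpen S) (hS' : IsOpen S')
    (hSS : ∀ p ∈ S, (Fin.snoc p 0 : Fin (n + 1 + 2) → ℝ) ∈ S')
    {g : (Fin (n + 2) → ℝ) → ℝ} {g' : (Fin (n + 1 + 2) → ℝ) → ℝ} (hg' : ContDiffOn ℝ ∞ g' S')
    (h : ∀ p ∈ S, g' (Fin.snoc p 0) = g p) {p : Fin (n + 2) → ℝ} (hp : p ∈ S) :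
    jet g' (Fin.snoc p 0) = jet g p := by
  have key : ∀ j, ∀ p ∈ S, ((pd 0)^[j] g') (Fin.snoc p 0) = ((pd 0)^[j] g) p := by
    intro j
    induction j with
    | zero => exact h
    | succ j ih =>
      intro p hp
      rw [Function.iterate_succ_apply', Function.iterate_succ_apply']
      exact pd_restrict hS hS' hSS (contDiffOn_iterate_pd hS' hg' 0 j) ih 0 hp
  have hy : extendByZero (Fin.snoc p 0 : Fin (n + 1 + 2) → ℝ) = extendByZero p :=
    extendByZero_snoc p
  simp only [jet, hy, key _ p hp]

/-- The quotients `Δ_c/Δ` are the unknowns of the linear system with matrix `jac Υ` and right-hand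
side `rotCol`. On the hyperplane the last component of `Υ'` vanishes, so the last unknown disappears
from the first `n + 2` rows. What remains is the system of level `n`, whose solution is unique. -/
theorem DelCol_div_Del_restrict (hS : IsOpen S) (hS' : IsOpen S')
    (hSS : ∀ p ∈ S, (Fin.snoc p 0 : Fin (n + 1 + 2) → ℝ) ∈ S') {θ : Fin 3 → ℕ → Jet → ℝ}
    {u μ : (Fin (n + 2) → ℝ) → ℝ} {u' μ' : (Fin (n + 1 + 2) → ℝ) → ℝ}
    {Υ : (Fin (n + 2) → ℝ) → (Fin (n + 2) → ℝ)}
    {Υ' : (Fin (n + 1 + 2) → ℝ) → (Fin (n + 1 + 2) → ℝ)}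
    (hu' : ContDiffOn ℝ ∞ u' S') (hΥ' : ContDiffOn ℝ ∞ Υ' S')
    (hu : ∀ p ∈ S, u' (Fin.snoc p 0) = u p) (hμ : ∀ p ∈ S, μ' (Fin.snoc p 0) = μ p)
    (hΥ : ∀ p ∈ S, Υ' (Fin.snoc p 0) = Fin.snoc (Υ p) 0)
    (hdet : ∀ p ∈ S, Del Υ p ≠ 0) (hdet' : ∀ p ∈ S', Del Υ' p ≠ 0) {p : Fin (n + 2) → ℝ}
    (hp : p ∈ S) :
    DelCol θ u' Υ' μ' 0 (Fin.snoc p 0) / Del Υ' (Fin.snoc p 0) =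
      DelCol θ u Υ μ 0 p / Del Υ p := by
  have hp' := hSS p hp
  set p' : Fin (n + 1 + 2) → ℝ := Fin.snoc p 0 with hp'def
  have hJ : ∀ r c : Fin (n + 2), jac Υ' p' r.castSucc c.castSucc = jac Υ p r c := fun r c =>
    pd_restrict hS hS' hSS (contDiffOn_component hΥ' c.castSucc)
      (fun q hq => by rw [hΥ q hq]; exact Fin.snoc_castSucc (α := fun _ => ℝ) 0 (Υ q) c) r hp
  have hJ0 : ∀ r : Fin (n + 2), jac Υ' p' r.castSucc (Fin.last (n + 2)) = 0 := fun r => by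
    have h0 : pd r.castSucc (fun q => Υ' q (Fin.last (n + 2))) p' = pd r (fun _ => (0 : ℝ)) p :=
      pd_restrict hS hS' hSS (contDiffOn_component hΥ' (Fin.last (n + 2)))
        (fun q hq => by rw [hΥ q hq]; exact Fin.snoc_last (α := fun _ => ℝ) 0 (Υ q)) r hp
    refine h0.trans ?_
    simp [pd]
  have hb : ∀ r : Fin (n + 2), rotCol θ u' μ' p' r.castSucc = rotCol θ u μ p r := fun r => by
    simp only [rotCol, hp'def, jet_restrict hS hS' hSS hu' hu hp, hμ p hp, Fin.val_castSucc]
  have h1 := (eq_of_cramer (hdet p hp) (a := fun c => DelCol θ u Υ μ c p / Del Υ p)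
    (b := rotCol θ u μ p)).2 fun c => mul_div_cancel₀ _ (hdet p hp)
  have h2 := (eq_of_cramer (hdet' p' hp') (a := fun c => DelCol θ u' Υ' μ' c p' / Del Υ' p')
    (b := rotCol θ u' μ' p')).2 fun c => mul_div_cancel₀ _ (hdet' p' hp')
  have h3 : (jac Υ p).mulVec
      (fun c : Fin (n + 2) => DelCol θ u' Υ' μ' c.castSucc p' / Del Υ' p') = rotCol θ u μ p := by
    ext r
    rw [← hb r, ← congrFun h2 r.castSucc]
    simp only [Matrix.mulVec, dotProduct]
    refine Eq.trans ?_ (Fin.sum_univ_castSucc (n := n + 2) _).symm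
    rw [hJ0 r, zero_mul, add_zero]
    exact Finset.sum_congr rfl fun c _ => by rw [hJ]
  have hu' : IsUnit (jac Υ p) := (Matrix.isUnit_iff_isUnit_det _).2 (hdet p hp).isUnit
  exact congrFun (Matrix.mulVec_injective_iff_isUnit.2 hu' (h3.trans h1.symm)) 0

end

/-! ### Domains of injectivity -/

/-- An injective local diffeomorphism need not stay injective on a neighbourhood of an open set, but
it does near a compact one. So compact sets are chosen, each embedded in the interior of the next,
and `W n` is the interior of the `n`-th. -/
theorem exists_nested_injOn {V : ∀ n : ℕ, Set (Fin (n + 2) → ℝ)} (hV : NestedDomains V)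
    {Υ : ∀ n : ℕ, (Fin (n + 2) → ℝ) → (Fin (n + 2) → ℝ)}
    (hΥ : ∀ n, IsLocalDiffeomorphOn 𝓘(ℝ, Fin (n + 2) → ℝ) 𝓘(ℝ, Fin (n + 2) → ℝ) ∞ (Υ n) (V n))
    (hΥres : ∀ n, ∀ p ∈ V n, Υ (n + 1) (Fin.snoc p 0) = Fin.snoc (Υ n p) 0)
    {p : Fin (0 + 2) → ℝ} (hp : p ∈ V 0) :
    ∃ W : ∀ n : ℕ, Set (Fin (n + 2) → ℝ), NestedDomains W ∧
      (∀ n, W n ⊆ V n) ∧ (∀ n, Set.InjOn (Υ n) (W n)) ∧ p ∈ W 0 := by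
  have enlarge : ∀ n (C : Set (Fin (n + 2) → ℝ)), IsCompact C → C ⊆ V n → Set.InjOn (Υ n) C →
      ∃ K, (IsCompact K ∧ K ⊆ V n ∧ Set.InjOn (Υ n) K) ∧ C ⊆ interior K := by
    intro n C hC hCV hinj
    have hc : ∀ x ∈ C, ContinuousAt (Υ n) x := fun x hx =>
      (differentiableAt_of_contDiffOn (hV.isOpen n)
        (contDiffOn_of_isLocalDiffeomorphOn (hΥ n)) (hCV hx)).continuousAt
    -- Injectivity on a compact set and local injectivity at its points give injectivity on an open
    -- neighbourhood.
    obtain ⟨t, ht, hCt, htinj⟩ := hinj.exists_isOpen_superset hC hc fun x hx =>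
      exists_injOn_nhds (hV.isOpen n) (hΥ n) (hCV hx)
    obtain ⟨K, hK, hCK, hKt⟩ := exists_compact_between hC (ht.inter (hV.isOpen n))
      (Set.subset_inter hCt hCV)
    exact ⟨K, ⟨hK, fun x hx => (hKt hx).2, htinj.mono fun x hx => (hKt hx).1⟩, hCK⟩
  obtain ⟨K₀, hK₀, hpK₀⟩ := enlarge 0 {p} isCompact_singleton (by simpa using hp)
    (Set.injOn_singleton _ _)
  -- The subtype carries compactness, inclusion and injectivity through the recursion.
  have step : ∀ n (K : {K : Set (Fin (n + 2) → ℝ) // IsCompact K ∧ K ⊆ V n ∧ Set.InjOn (Υ n) K}),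
      ∃ K' : {K : Set (Fin (n + 1 + 2) → ℝ) //
        IsCompact K ∧ K ⊆ V (n + 1) ∧ Set.InjOn (Υ (n + 1)) K},
        ∀ q ∈ K.1, (Fin.snoc q 0 : Fin (n + 1 + 2) → ℝ) ∈ interior K'.1 := by
    rintro n ⟨K, hK, hKV, hKinj⟩
    obtain ⟨K', hK', hKK'⟩ := enlarge (n + 1)
      ((fun q : Fin (n + 2) → ℝ => (Fin.snoc q 0 : Fin (n + 1 + 2) → ℝ)) '' K)
      (hK.image (continuous_snoc (n + 2))) (by
        rintro _ ⟨q, hq, rfl⟩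
        exact hV.nested n q (hKV hq)) (by
        rintro _ ⟨a, ha, rfl⟩ _ ⟨b, hb, rfl⟩ hab
        simp only [hΥres n a (hKV ha), hΥres n b (hKV hb)] at hab
        have := snoc_injective (n + 2) hab
        rw [hKinj ha hb this])
    exact ⟨⟨K', hK'⟩, fun q hq => hKK' ⟨q, hq, rfl⟩⟩
  choose next hnext using step
  let K : ∀ n, {K : Set (Fin (n + 2) → ℝ) // IsCompact K ∧ K ⊆ V n ∧ Set.InjOn (Υ n) K} :=
    fun n => Nat.rec ⟨K₀, hK₀⟩ next n
  have hp0 : p ∈ interior (K 0).1 := hpK₀ rfl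
  exact ⟨fun n => interior (K n).1, ⟨fun n => isOpen_interior, ⟨p, hp0⟩,
    fun n q hq => hnext n (K n) q (interior_subset hq)⟩,
    fun n => interior_subset.trans (K n).2.2.1,
    fun n => (K n).2.2.2.mono interior_subset, hp0⟩

/-! ### Genericity -/

/-- The area form does not depend on the choice of orthonormal coframe within its orientation. -/
theorem wedge_rotForms {m : ℕ} (η : Fin 3 → Fin m → (Fin m → ℝ) → ℝ) (μ : (Fin m → ℝ) → ℝ)
    (p : Fin m → ℝ) (r s : Fin m) :
    wedge (rotForms η μ 0) (rotForms η μ 1) p r s = wedge (η 0) (η 1) p r s := by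
  have v0 : ∀ r, rotForms η μ 0 r p =
    η 0 r p * Real.cos (μ p) + η 1 r p * Real.sin (μ p) := fun r => rfl
  have v1 : ∀ r, rotForms η μ 1 r p =
    η 1 r p * Real.cos (μ p) - η 0 r p * Real.sin (μ p) := fun r => rfl
  simp only [wedge, v0, v1]
  linear_combination (η 0 r p * η 1 s p - η 0 s p * η 1 r p) * Real.sin_sq_add_cos_sq (μ p)

/-- In two variables a two-form has a single coefficient. If it vanished at `Υ p` on `û`, its
pull-back would vanish at `p`, and that pull-back is `Θ₁ ∧ Θ₂` on `u`. -/
theorem isIIIGeneric_image {θ θh : Fin 3 → ℕ → Jet → ℝ} {S : Set (Fin (0 + 2) → ℝ)}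
    {Υ : (Fin (0 + 2) → ℝ) → (Fin (0 + 2) → ℝ)} {u v μ : (Fin (0 + 2) → ℝ) → ℝ}
    (hgen : IsIIIGeneric θ S u)
    (h : ∀ α r, Set.EqOn (pull Υ (evalForms θh v α) r) (rotForms (evalForms θ u) μ α r) S) :
    IsIIIGeneric θh (Υ '' S) v := by
  rintro _ ⟨p, hp, rfl⟩ h0
  have hz : ∀ r s, wedge (evalForms θh v 0) (evalForms θh v 1) (Υ p) r s = 0 := by
    have h01 : wedge (evalForms θh v 0) (evalForms θh v 1) (Υ p) 0 1 = 0 := h0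
    intro r s
    fin_cases r <;> fin_cases s
    · exact sub_self _
    · exact h01
    · have := neg_eq_zero.2 h01
      rwa [wedge, neg_sub] at this
    · exact sub_self _
  have hw := wedge_pull Υ (evalForms θh v 0) (evalForms θh v 1) p 0 1
  rw [wedge_congr (h 0) (h 1) hp, wedge_rotForms, mul_mul_transpose_apply] at hw
  simp only [Matrix.of_apply, hz, mul_zero, zero_mul, Finset.sum_const_zero] at hw
  exact hgen p hp hw

end PSS

/-! ### Assembling the levels -/

theorem mainTheorem2
    -- two hierarchies of strictly pseudo-spherical type
    (F : ℕ → PSS.Jet → ℝ) (θ : Fin 3 → ℕ → PSS.Jet → ℝ)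
    (Fh : ℕ → PSS.Jet → ℝ) (θh : Fin 3 → ℕ → PSS.Jet → ℝ)
    (hF : PSS.IsStrictPSSHierarchy F θ) (hFh : PSS.IsStrictPSSHierarchy Fh θh)
    -- the function `f̂₁₁` is `G(û)`, and `G'` vanishes nowhere
    (G : ℝ → ℝ) (hG : ContDiff ℝ ∞ G) (hG' : ∀ s, deriv G s ≠ 0)
    (hGf : ∀ z : PSS.Jet, θh 0 0 z = G (z.u 0))
    -- a solution of the first hierarchy, with III-generic `u^{[0]}`
    (U : ∀ n : ℕ, Set (Fin (n + 2) → ℝ)) (u : ∀ n : ℕ, (Fin (n + 2) → ℝ) → ℝ)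
    (hu : PSS.IsSolution F U u) (hgen : PSS.IsIIIGeneric θ (U 0) (u 0))
    -- a compatible solution of the first-order system, consisting of local diffeomorphisms
    -- `Υ^{[n]}` and smooth functions `μ^{[n]}` on `V^{[n]}`
    (V : ∀ n : ℕ, Set (Fin (n + 2) → ℝ)) (hV : PSS.NestedDomains V) (hVU : ∀ n, V n ⊆ U n)
    (Υ : ∀ n : ℕ, (Fin (n + 2) → ℝ) → (Fin (n + 2) → ℝ))
    (μ : ∀ n : ℕ, (Fin (n + 2) → ℝ) → ℝ)
    (hΥ : ∀ n, IsLocalDiffeomorphOn 𝓘(ℝ, Fin (n + 2) → ℝ) 𝓘(ℝ, Fin (n + 2) → ℝ) ∞ (Υ n) (V n))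
    (hμ : ∀ n, ContDiffOn ℝ ∞ (μ n) (V n))
    (hΥres : ∀ n, ∀ p ∈ V n, Υ (n + 1) (Fin.snoc p 0) = Fin.snoc (Υ n p) 0)
    (hμres : ∀ n, ∀ p ∈ V n, μ (n + 1) (Fin.snoc p 0) = μ n p)
    (hsys : ∀ n, PSS.SolvesSystem θ θh G (u n) (V n) (Υ n) (μ n)) :
    -- through every point there are nested domains on which the maps `Υ^{[n]}` are injective
    (∀ p ∈ V 0, ∃ W : ∀ n : ℕ, Set (Fin (n + 2) → ℝ), PSS.NestedDomains W ∧
      (∀ n, W n ⊆ V n) ∧ (∀ n, Set.InjOn (Υ n) (W n)) ∧ p ∈ W 0) ∧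
    -- on the images of any such domains, `f̂₁₁ ∘ Υ^{[n]} = Δ₁^{[n]} / Δ^{[n]}` determines a
    -- III-generic solution of the second hierarchy
    (∀ W : ∀ n : ℕ, Set (Fin (n + 2) → ℝ), PSS.NestedDomains W →
      (∀ n, W n ⊆ V n) → (∀ n, Set.InjOn (Υ n) (W n)) →
      ∃ uh : ∀ n : ℕ, (Fin (n + 2) → ℝ) → ℝ,
        (∀ n, ∀ p ∈ W n, θh 0 0 (PSS.jet (uh n) (Υ n p)) =
          PSS.DelCol θ (u n) (Υ n) (μ n) 0 p / PSS.Del (Υ n) p) ∧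
        PSS.IsSolution Fh (fun n => Υ n '' W n) uh ∧
        PSS.IsIIIGeneric θh (Υ 0 '' W 0) (uh 0) ∧
        (∀ v : ∀ n : ℕ, (Fin (n + 2) → ℝ) → ℝ,
          (∀ n, ∀ p ∈ W n, θh 0 0 (PSS.jet (v n) (Υ n p)) =
            PSS.DelCol θ (u n) (Υ n) (μ n) 0 p / PSS.Del (Υ n) p) →
          ∀ n, Set.EqOn (v n) (uh n) (Υ n '' W n))) := by
  refine ⟨fun p hp => PSS.exists_nested_injOn hV hΥ hΥres hp, fun W hW hWV hinj => ?_⟩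
  have hWU : ∀ n, W n ⊆ U n := fun n => (hWV n).trans (hVU n)
  have hΥW : ∀ n, IsLocalDiffeomorphOn 𝓘(ℝ, Fin (n + 2) → ℝ) 𝓘(ℝ, Fin (n + 2) → ℝ) ∞
      (Υ n) (W n) := fun n x => hΥ n ⟨x, hWV n x.2⟩
  have hsysW : ∀ n, PSS.SolvesSystem θ θh G (u n) (W n) (Υ n) (μ n) := fun n => by
    obtain ⟨w, h0, h1, h2, h3⟩ := hsys n
    exact ⟨w, fun p hp => h0 p (hWV n hp), fun p hp => h1 p (hWV n hp),
      fun p hp => h2 p (hWV n hp), fun p hp => h3 p (hWV n hp)⟩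
  have hdet : ∀ n, ∀ p ∈ W n, PSS.Del (Υ n) p ≠ 0 := fun n p hp =>
    PSS.Del_ne_zero (hW.isOpen n) (hΥW n) hp
  have hGinj := PSS.injective_of_deriv_ne_zero hG hG'
  -- The `û^{[n]}` are obtained independently at each level; their compatibility is proved
  -- afterwards.
  choose v hvc hveq hvG hvpull using fun n =>
    PSS.exists_transformed_solution hF.toIsPSSHierarchy hFh hG hG' hGf (hW.isOpen n)
      ((hu.smooth n).mono (hWU n)) (fun i p hp => hu.equation n i p (hWU n hp)) (hΥW n) (hinj n)
      ((hμ n).mono (hWV n)) (hsysW n)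
  have hGjet : ∀ n (g : (Fin (n + 2) → ℝ) → ℝ) q, θh 0 0 (PSS.jet g q) = G (g q) :=
    fun n g q => hGf _
  refine ⟨v, fun n p hp => by rw [hGjet, hvG n p hp], ⟨⟨fun n => ?_, ?_, ?_⟩, hvc, hveq, ?_⟩,
    PSS.isIIIGeneric_image (fun p hp => hgen p (hWU 0 hp)) (hvpull 0), ?_⟩
  · exact PSS.isOpen_image_of_isLocalDiffeomorphOn (hW.isOpen n) (hΥW n)
  · exact hW.nonempty.image _
  · rintro n _ ⟨p, hp, rfl⟩
    exact ⟨_, hW.nested n p hp, hΥres n p (hWV n hp)⟩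
  · rintro n _ ⟨p, hp, rfl⟩
    -- Since `G` is injective, it suffices that the quotients `Δ₁/Δ` of consecutive levels agree on
    -- the hyperplane.
    apply hGinj
    rw [← hΥres n p (hWV n hp), hvG n p hp, hvG (n + 1) _ (hW.nested n p hp)]
    exact PSS.DelCol_div_Del_restrict (hW.isOpen n) (hW.isOpen (n + 1)) (hW.nested n)
      ((hu.smooth (n + 1)).mono (hWU (n + 1)))
      (PSS.contDiffOn_of_isLocalDiffeomorphOn (hΥW (n + 1)))
      (fun q hq => hu.restrict n q (hWU n hq)) (fun q hq => hμres n q (hWV n hq))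
      (fun q hq => hΥres n q (hWV n hq)) (hdet n) (hdet (n + 1)) hp
  · rintro v' hv' n _ ⟨p, hp, rfl⟩
    apply hGinj
    rw [hvG n p hp, ← hGjet, hv' n p hp]
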